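/- Let $N\ge 2$, $\ell>0$ and $S_0\neq 0$. For functions $m(r)$, $S(r)$, $\omega_j(r)$ ($1\le j\le N-1$) and $\alpha_j(r)$ ($1\le j\le N$) with $\sum_{j=1}^N\alpha_j=0$ put $\alpha_0=\alpha_{N+1}=\omega_0=\omega_N=0$, $\mathcal E_j=\alpha_j-\alpha_{j+1}$, and $$\mu=\kappa-\frac{2m}{r}+\frac{r^2}{\ell^2},\quad \eta=\sum_{j=1}^N\alpha_j'^2,\quad \zeta=\sum_{j=1}^{N-1}\omega_j^2\mathcal E_j^2,\quad G=\sum_{j=1}^{N-1}\omega_j'^2,\quad P=\frac1{4r^2}\sum_{j=1}^N\bigl(\omega_j^2-\omega_{j-1}^2-\kappa(N+1-2j)\bigr)^2 .$$ The dyonic $\mathfrak{su}(N)$ Einstein-Yang-Mills field equations for curvature index $\kappa\in\{-1,0,1\}$ ($\kappa=1$: spherical symmetry) with negative cosmological constant $\Lambda=-3/\ell^2$ are $$m'=\frac{r^2\eta}{4S^2}+\frac{\zeta}{4\mu S^2}+\mu G+P,\qquad \frac{S'}{S}=\frac{\zeta}{2\mu^2S^2r}+\frac{2G}{r},$$ $$\mathcal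 E_j''=\Bigl(\frac{S'}{S}-\frac2r\Bigr)\mathcal E_j'+\frac{1}{\mu r^2}\bigl(2\omega_j^2\mathcal E_j-\omega_{j-1}^2\mathcal E_{j-1}-\omega_{j+1}^2\mathcal E_{j+1}\bigr),$$ $$r^2\mu\,\omega_j''=-2\Bigl(m-rP+\frac{r^3}{\ell^2}-\frac{r^3\eta}{4S^2}\Bigr)\omega_j'-\frac{r^2}{4\mu S^2}\omega_j\mathcal E_j^2-\Bigl(\kappa-\omega_j^2+\tfrac12(\omega_{j+1}^2+\omega_{j-1}^2)\Bigr)\omega_j$$ for $1\le j\le N-1$. Let $A$ be the $(N-1)\times(N-1)$ tridiagonal matrix $A^i_j=(2\delta^i_j-\delta^{i-1}_j-\delta^{i+1}_j)\,j(N-j)$, and for $1\le k,j\le N-1$ let $$v_k^j=\frac{N-1}{N-j}\;{}_3F_2\bigl(-k,\,1-j,\,k+1;\;2,\,1-N;\;1\bigr).$$ Then, for each $1\le k\le N-1$, the vector $v_k=(v_k^1,\dots,v_k^{N-1})^T$ is an eigenvector of $A$ with eigenvalue $k(k+1)$. Moreover, for $\kappa=1$ in the field equations, there is a $(2N-2)$-parameter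 family of solutions regular at $r=0$, as follows. There are an open set $U\subset\mathbb R\times\mathbb R^{2N-2}$ containing $(0,p)$ for every $p=(\breve\beta_1,\dots,\breve\beta_{N-1},\breve\theta_1,\dots,\breve\theta_{N-1})\in\mathbb R^{2N-2}$, and functions $m,S,\alpha_j,\omega_j,\bar\beta_k,\bar\theta_k$ of $(r,p)$, jointly real-analytic on $U$ (hence analytic in $r$ near $0$ and in the initial parameters), such that: 1. for every $(r,p)\in U$ one has $\mu>0$ and $S\ne0$, and if $r\neq0$ then the field equations with $\kappa=1$ hold at $r$ for the solution with parameter $p$; 2. for every $p$, as $r\to0$, $m=O(r^3)$ and $S=S_0+O(r^2)$, with $S=S_0$ at $r=0$; 3. on $U$, for $1\le j\le N-1$, $$\omega_j=\sqrt{j(N-j)}\,\Bigl(1+\sum_{k=1}^{N-1}\bar\beta_k\,v^j_k\,r^{k+1}\Bigr),\qquad \mathcal E_j=\sum_{k=1}^{N-1}\bar\theta_k\,v_k^j\,r^{k},$$ and $\bar\beta_k(0,p)=\breve\beta_k$, $\bar\theta_k(0,p)=\breve\theta_k$ for all $p$ and $1\le k\le N-1$. -/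

import Mathlib

open Asymptotics

noncomputable section

namespace EYM

/-- The radial field variables of a static `su(N)` Einstein-Yang-Mills configuration: the mass
function `m`, the metric function `S`, the electric gauge functions `α j` (`1 ≤ j ≤ N`) and the
magnetic gauge functions `ω j` (`1 ≤ j ≤ N - 1`). -/
structure Fields where
  m : ℝ → ℝ
  S : ℝ → ℝ
  α : ℕ → ℝ → ℝ
  ω : ℕ → ℝ → ℝ

namespace Fields

/-- The differences `ℰ_j = α_j - α_{j+1}`, in which the electric equations are written. -/
def E (F : Fields) (j : ℕ) (r : ℝ) : ℝ := F.α j r - F.α (j + 1) r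

/-- The metric function `μ`, where `k` is the curvature of the symmetric surfaces and `ℓ` the
anti-de Sitter radius. -/
def μ (F : Fields) (k ℓ r : ℝ) : ℝ := k - 2 * F.m r / r + r ^ 2 / ℓ ^ 2

def η (F : Fields) (N : ℕ) (r : ℝ) : ℝ := ∑ j ∈ Finset.Icc 1 N, deriv (F.α j) r ^ 2

def ζ (F : Fields) (N : ℕ) (r : ℝ) : ℝ :=
  ∑ j ∈ Finset.Icc 1 (N - 1), F.ω j r ^ 2 * F.E j r ^ 2

def G (F : Fields) (N : ℕ) (r : ℝ) : ℝ := ∑ j ∈ Finset.Icc 1 (N - 1), deriv (F.ω j) r ^ 2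

def P (F : Fields) (k : ℝ) (N : ℕ) (r : ℝ) : ℝ :=
  1 / (4 * r ^ 2) * ∑ j ∈ Finset.Icc 1 N,
    (F.ω j r ^ 2 - F.ω (j - 1) r ^ 2 - k * ((N : ℝ) + 1 - 2 * j)) ^ 2

def W (F : Fields) (k : ℝ) (j : ℕ) (r : ℝ) : ℝ :=
  k - F.ω j r ^ 2 + 1 / 2 * (F.ω (j + 1) r ^ 2 + F.ω (j - 1) r ^ 2)

def Z (F : Fields) (j : ℕ) (r : ℝ) : ℝ :=
  2 * F.ω j r ^ 2 * F.E j r - F.ω (j - 1) r ^ 2 * F.E (j - 1) r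
    - F.ω (j + 1) r ^ 2 * F.E (j + 1) r

/-- The field equations at the radius `r`: the boundary conventions
`α_0 = α_{N+1} = ω_0 = ω_N = 0`, the tracelessness of the electric part, the two Einstein
equations and the `2N - 2` Yang-Mills equations. -/
structure FieldEquationsAt (F : Fields) (k ℓ : ℝ) (N : ℕ) (r : ℝ) : Prop where
  alpha_zero : F.α 0 r = 0
  alpha_last : F.α (N + 1) r = 0
  omega_zero : F.ω 0 r = 0
  omega_last : F.ω N r = 0
  traceless : ∑ j ∈ Finset.Icc 1 N, F.α j r = 0
  einstein₁ : deriv F.m r =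
    r ^ 2 * F.η N r / (4 * F.S r ^ 2) + F.ζ N r / (4 * F.μ k ℓ r * F.S r ^ 2)
      + F.μ k ℓ r * F.G N r + F.P k N r
  einstein₂ : deriv F.S r / F.S r =
    F.ζ N r / (2 * F.μ k ℓ r ^ 2 * F.S r ^ 2 * r) + 2 * F.G N r / r
  electric : ∀ j ∈ Finset.Icc 1 (N - 1), deriv (deriv (F.E j)) r =
    (deriv F.S r / F.S r - 2 / r) * deriv (F.E j) r + 1 / (F.μ k ℓ r * r ^ 2) * F.Z j r
  magnetic : ∀ j ∈ Finset.Icc 1 (N - 1), r ^ 2 * F.μ k ℓ r * deriv (deriv (F.ω j)) r =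
    -2 * (F.m r - r * F.P k N r + r ^ 3 / ℓ ^ 2 - r ^ 3 * F.η N r / (4 * F.S r ^ 2))
        * deriv (F.ω j) r
      - r ^ 2 / (4 * F.μ k ℓ r * F.S r ^ 2) * F.ω j r * F.E j r ^ 2
      - F.W k j r * F.ω j r

end Fields

/-- `γ_j = j (N - j)`. -/
def γ (N j : ℕ) : ℝ := (j : ℝ) * ((N : ℝ) - j)

/-- The tridiagonal matrix `A^i_j = (2 δ^i_j - δ^{i-1}_j - δ^{i+1}_j) γ_j`, `1 ≤ i, j ≤ N - 1`
(the index `i : Fin (N - 1)` stands for `i + 1`). -/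
def A (N : ℕ) : Matrix (Fin (N - 1)) (Fin (N - 1)) ℝ := fun i j =>
  ((if i = j then 2 else 0) - (if (i : ℕ) = j + 1 then 1 else 0)
    - (if (i : ℕ) + 1 = j then 1 else 0)) * γ N (j + 1)

/-- The Hahn polynomial `Q_k(x) = ₃F₂(-k, -x, k + 1; 2, -(N - 1); 1)`, that is, the Hahn
polynomial with parameters `(1, -1, N - 1)`, for `k ≤ N - 1`. -/
def hahn (N k : ℕ) (x : ℝ) : ℝ :=
  ∑ i ∈ Finset.range (k + 1),
    ((ascPochhammer ℝ i).eval (-(k : ℝ)) * (ascPochhammer ℝ i).eval (-x)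
        * (ascPochhammer ℝ i).eval ((k : ℝ) + 1))
      / ((ascPochhammer ℝ i).eval 2 * (ascPochhammer ℝ i).eval (-((N : ℝ) - 1))
        * (i.factorial : ℝ))

/-- `v_k^j = (N - 1) / (N - j) * Q_k(j - 1)` for `1 ≤ j, k ≤ N - 1`. -/
def v (N k j : ℕ) : ℝ := ((N : ℝ) - 1) / ((N : ℝ) - j) * hahn N k ((j : ℝ) - 1)

/-- The space of the `2N - 2` initial parameters: `p.1 k` is `β̆_{k+1}`, `p.2 k` is `θ̆_{k+1}`. -/
abbrev Params (N : ℕ) : Type := (Fin (N - 1) → ℝ) × (Fin (N - 1) → ℝ)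

end EYM

end

/-! The substitution is `ω_j = √γ_j (1 + u_j)`, with `u_j` and `ℰ_j` expanded in the eigenvectors
`v_k` with weights `r^{k+1}` and `r^k`. It works because the indicial equations at `r = 0` match the
spectrum of `A`. The linear operators `r² u''` and `r² ℰ'' + 2 r ℰ'` send the leading terms of mode
`k` to `k(k+1)` times themselves, and this is the eigenvalue of `A` on `v_k`. The singular terms
therefore cancel, and each coefficient `b` satisfies `r b'' + (2k+2) b' = r (...)`.

The right-hand side must then be analytic at `r = 0`. The danger is in the nonlinear terms:
projecting a product of modes onto mode `c` could produce negative powers of `r`. They do not occur,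
since `v_{a+1}^j` is a polynomial of degree `a` in `j`. A product of two such vectors thus involves
only `v_{c+1}` with `c ≤ a + b` (`exists_structure_constants`), leaving the power `r^{a+b-c}`. Both
the eigenvector property and the polynomiality come from the difference equation of the Hahn
polynomials (`hahn_difference_equation`, `exists_polynomial_v`).

The outcome is a system `r y_i' = -e_i (y_i - c_i) + r f_i(r, y, M)` coupled to `r M' = -3 M + h(r,
y)`, where `M = m / r³`. The last equation has no factor `r` in front of its source. To keep `h`
independent of `M`, the quotient `m / r` is carried as a separate component of `y`, so that `M` is
simply a weighted average of `h` along the curve.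

The system is solved in integral form. Rescaling the segment from `0` to `r` onto `[0, 1]` gives `x
= c + r K(r, x)` on continuous curves. The operator `K` is analytic at `r = 0` and constant `x`
(`analyticAt_nemytskii`), so the analytic inverse function theorem gives solutions analytic in `r`
and `c` jointly (`exists_analyticAt_fixedPoint`, `exists_local_solution`). Uniqueness and the
identity theorem glue them over all parameters (`exists_solution`), and `fieldEquationsAt_toFields`
translates back. -/

open Asymptotics

noncomputable section

namespace EYM

/-! ### Analyticity of nonlinear postcomposition on `C(I, ℝ)`. -/

section

open Filter Topology
open scoped unitInterval ENNReal NNReal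

section Nemytskii

variable {X E : Type*} [NormedAddCommGroup X] [NormedSpace ℝ X]
  [NormedAddCommGroup E] [NormedSpace ℝ E]

/-- The postcomposition `x ↦ (t ↦ f (ev t x))` with a nonlinear function `f`, along a family of
evaluation maps `ev t : X → E`. -/
def nemytskii (ev : I → X →L[ℝ] E) (f : E → ℝ) (x : X) : C(I, ℝ) :=
  open Classical in
  if h : Continuous fun t => f (ev t x) then ⟨_, h⟩ else 0

theorem nemytskii_apply {ev : I → X →L[ℝ] E} {f : E → ℝ} {x : X}
    (h : Continuous fun t => f (ev t x)) (t : I) : nemytskii ev f x t = f (ev t x) := by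
  simp [nemytskii, h]

/-- The evaluations are contractions sending `x₀` to a single point, so for `x` near `x₀` all values
`ev t x` lie in one ball on which `f` is analytic. There the default value `0` in `nemytskii` is
never taken. -/
theorem eventually_nemytskii_apply {ev : I → X →L[ℝ] E} (hev : ∀ t x, ‖ev t x‖ ≤ ‖x‖)
    (hc : ∀ x, Continuous fun t => ev t x) {f : E → ℝ} {x₀ : X} {e₀ : E}
    (h₀ : ∀ t, ev t x₀ = e₀) (hf : AnalyticAt ℝ f e₀) :
    ∀ᶠ x in 𝓝 x₀, ∀ t, AnalyticAt ℝ f (ev t x) ∧ nemytskii ev f x t = f (ev t x) := by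
  obtain ⟨δ, hδ, hδ'⟩ := Metric.eventually_nhds_iff.1 hf.eventually_analyticAt
  filter_upwards [Metric.ball_mem_nhds x₀ hδ] with x hx
  have han : ∀ t, AnalyticAt ℝ f (ev t x) := fun t => by
    refine hδ' ?_
    rw [dist_eq_norm, ← h₀ t, ← map_sub]
    exact (hev t _).trans_lt (by simpa [dist_eq_norm] using hx)
  have hcont : Continuous fun t => f (ev t x) :=
    continuous_iff_continuousAt.2 fun t =>
      (han t).continuousAt.comp (f := fun t => ev t x) (hc x).continuousAt
  exact fun t => ⟨han t, nemytskii_apply hcont t⟩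

/-- The postcomposition of a continuous multilinear map, as a multilinear map into `C(I, ℝ)`. -/
def postcompMultilinear (ev : I → X →L[ℝ] E) (hev : ∀ t x, ‖ev t x‖ ≤ ‖x‖)
    (hc : ∀ x, Continuous fun t => ev t x) {n : ℕ}
    (p : ContinuousMultilinearMap ℝ (fun _ : Fin n => E) ℝ) :
    ContinuousMultilinearMap ℝ (fun _ : Fin n => X) C(I, ℝ) :=
  MultilinearMap.mkContinuous
    { toFun := fun x => ⟨fun t => p fun i => ev t (x i),
        p.cont.comp (continuous_pi fun i => hc (x i))⟩
      map_update_add' := fun m i x y => by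
        ext t
        exact (p.compContinuousLinearMap fun _ => ev t).map_update_add m i x y
      map_update_smul' := fun m i c x => by
        ext t
        exact (p.compContinuousLinearMap fun _ => ev t).map_update_smul m i c x }
    ‖p‖ fun m => by
      refine (ContinuousMap.norm_le _ (by positivity)).2 fun t => ?_
      refine (p.le_opNorm _).trans ?_
      gcongr with i
      exact hev t _

theorem norm_postcompMultilinear_le (ev : I → X →L[ℝ] E) (hev : ∀ t x, ‖ev t x‖ ≤ ‖x‖)
    (hc : ∀ x, Continuous fun t => ev t x) {n : ℕ}
    (p : ContinuousMultilinearMap ℝ (fun _ : Fin n => E) ℝ) :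
    ‖postcompMultilinear ev hev hc p‖ ≤ ‖p‖ :=
  MultilinearMap.mkContinuous_norm_le _ (norm_nonneg _) _

/-- Nonlinear postcomposition is analytic at the elements that all evaluations send to the same
point. -/
theorem analyticAt_nemytskii {ev : I → X →L[ℝ] E} (hev : ∀ t x, ‖ev t x‖ ≤ ‖x‖)
    (hc : ∀ x, Continuous fun t => ev t x) {f : E → ℝ} {x₀ : X} {e₀ : E}
    (h₀ : ∀ t, ev t x₀ = e₀) (hf : AnalyticAt ℝ f e₀) :
    AnalyticAt ℝ (nemytskii ev f) x₀ := by
  obtain ⟨δ, hδ, hN⟩ := Metric.eventually_nhds_iff.1 (eventually_nemytskii_apply hev hc h₀ hf)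
  obtain ⟨p, r, hp⟩ := hf
  -- The power series of `f`, composed term by term with the evaluations. Norms do not increase, so
  -- it converges at least where the original does.
  let P : FormalMultilinearSeries ℝ X C(I, ℝ) := fun n => postcompMultilinear ev hev hc (p n)
  obtain ⟨ρ, hρ, hρr⟩ := ENNReal.lt_iff_exists_nnreal_btwn.1
    (lt_min hp.r_pos (ENNReal.ofReal_pos.2 hδ))
  have hρr' : (ρ : ℝ≥0∞) < r := hρr.trans_le (min_le_left _ _)
  have hρδ : (ρ : ℝ) < δ := by
    have := hρr.trans_le (min_le_right _ _)
    rwa [← ENNReal.ofReal_coe_nnreal, ENNReal.ofReal_lt_ofReal_iff hδ] at this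
  have hsum := p.summable_norm_mul_pow (hρr'.trans_le hp.r_le)
  refine ⟨P, ρ, ?_, hρ, ?_⟩
  · refine P.le_radius_of_summable (hsum.of_nonneg_of_le (fun n => by positivity) fun n => ?_)
    gcongr
    exact norm_postcompMultilinear_le ev hev hc (p n)
  · intro y hy
    have hy' : ‖y‖ < ρ := by simpa using hy
    have hS : Summable fun n => P n fun _ => y := by
      refine Summable.of_norm_bounded hsum fun n => ((P n).le_opNorm _).trans ?_
      simp only [Finset.prod_const, Finset.card_univ, Fintype.card_fin]
      gcongr
      exact norm_postcompMultilinear_le ev hev hc (p n)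
    -- The sum in `C(I, ℝ)` is identified pointwise: at each `t` both sides are sums of the series
    -- of `f` at `e₀`.
    suffices key : nemytskii ev f (x₀ + y) = ∑' n, P n fun _ => y by
      rw [key]
      exact hS.hasSum
    ext t
    have h1 : HasSum (fun n => p n fun _ => ev t y) (f (e₀ + ev t y)) := by
      refine hp.hasSum ?_
      have : ‖ev t y‖₊ < ρ := (hev t y).trans_lt hy'
      refine lt_trans ?_ hρr'
      simpa using this
    have h2 := (ContinuousMap.evalCLM ℝ t).hasSum hS.hasSum
    have h3 : nemytskii ev f (x₀ + y) t = f (e₀ + ev t y) := by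
      rw [(hN (by simpa using hy'.trans hρδ) t).2, map_add, h₀]
    rw [h3]
    exact h1.unique h2

end Nemytskii

end

/-! ### The fixed point equation and the rescaled integral operators. -/

section

open Filter Topology
open scoped unitInterval ENNReal NNReal

/-- Analytic solution of the fixed point equation `y = x + ρ K(ρ, y)` for small `ρ`. -/
theorem exists_analyticAt_fixedPoint {X : Type*} [NormedAddCommGroup X] [NormedSpace ℝ X]
    [CompleteSpace X] {K : ℝ × X → X} {x₀ : X} (hK : AnalyticAt ℝ K (0, x₀)) :
    ∃ Y : ℝ × X → X, AnalyticAt ℝ Y (0, x₀) ∧ Y (0, x₀) = x₀ ∧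
      (∀ᶠ z in 𝓝 ((0 : ℝ), x₀), Y z - z.1 • K (z.1, Y z) = z.2) ∧
      ∀ᶠ w in 𝓝 ((0 : ℝ), x₀), Y (w.1, w.2 - w.1 • K w) = w.2 := by
  let T : ℝ × X → ℝ × X := fun w => (w.1, w.2 - w.1 • K w)
  have hT : AnalyticAt ℝ T (0, x₀) :=
    analyticAt_fst.prod (analyticAt_snd.sub (analyticAt_fst.smul hK))
  have hT₀ : T (0, x₀) = (0, x₀) := by simp [T]
  let k : X := K (0, x₀)
  -- At `ρ = 0` the derivative of `ρ K(ρ, y)` is `ρ ↦ ρ k`, whatever the derivative of `K`. Hence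
  -- that of `T` is a shear, with inverse of opposite sign.
  let Leq : (ℝ × X) ≃L[ℝ] (ℝ × X) := ContinuousLinearEquiv.equivOfInverse
    ((ContinuousLinearMap.fst ℝ ℝ X).prod (ContinuousLinearMap.snd ℝ ℝ X
      - (ContinuousLinearMap.fst ℝ ℝ X).smulRight k))
    ((ContinuousLinearMap.fst ℝ ℝ X).prod (ContinuousLinearMap.snd ℝ ℝ X
      + (ContinuousLinearMap.fst ℝ ℝ X).smulRight k))
    (fun w => by ext <;> simp) (fun w => by ext <;> simp)
  have hderiv : HasStrictFDerivAt T (Leq : (ℝ × X) →L[ℝ] (ℝ × X)) (0, x₀) := by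
    have h1 : HasStrictFDerivAt (fun w : ℝ × X => w.1) (ContinuousLinearMap.fst ℝ ℝ X) (0, x₀) :=
      hasStrictFDerivAt_fst
    have h2 : HasStrictFDerivAt (fun w : ℝ × X => w.2) (ContinuousLinearMap.snd ℝ ℝ X) (0, x₀) :=
      hasStrictFDerivAt_snd
    have h := h1.prodMk (h2.sub (h1.smul hK.hasStrictFDerivAt))
    have hL : (Leq : (ℝ × X) →L[ℝ] (ℝ × X)) = (ContinuousLinearMap.fst ℝ ℝ X).prod
        (ContinuousLinearMap.snd ℝ ℝ X - (((0 : ℝ), x₀).1 • fderiv ℝ K (0, x₀)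
          + (ContinuousLinearMap.fst ℝ ℝ X).smulRight (K (0, x₀)))) := by
      ext <;> simp [Leq, k]
    rw [hL]
    exact h
  let R := hderiv.toOpenPartialHomeomorph T
  have hR₀ : ((0 : ℝ), x₀) ∈ R.source := hderiv.mem_toOpenPartialHomeomorph_source
  have hRT : ∀ w, R w = T w := fun w => rfl
  have htar : ((0 : ℝ), x₀) ∈ R.target := by
    have := R.map_source hR₀
    rwa [hRT, hT₀] at this
  have hsymm₀ : R.symm (0, x₀) = (0, x₀) := by
    have := R.left_inv hR₀
    rwa [hRT, hT₀] at this
  have hsymm : AnalyticAt ℝ R.symm (0, x₀) := by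
    have := R.analyticAt_symm' (i := Leq) hR₀ hT hderiv.hasFDerivAt.fderiv
    rwa [hRT, hT₀] at this
  refine ⟨fun z => (R.symm z).2, analyticAt_snd.comp hsymm, by simp [hsymm₀], ?_, ?_⟩
  · filter_upwards [R.open_target.mem_nhds htar] with z hz
    have h : T (R.symm z) = z := R.right_inv hz
    have h1 : (T (R.symm z)).1 = z.1 := congrArg Prod.fst h
    change (R.symm z).1 = z.1 at h1
    have h2 := congrArg Prod.snd h
    simp only [T] at h2
    rwa [h1, show R.symm z = (z.1, (R.symm z).2) from Prod.ext h1 rfl] at h2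
  · filter_upwards [R.open_source.mem_nhds hR₀] with w hw
    have h : R.symm (T w) = w := R.left_inv hw
    exact congrArg Prod.snd h

/-- The averaging operator `g ↦ (t ↦ ∫₀¹ s ^ k g (t s) ds)`. -/
def average (k : ℕ) : C(I, ℝ) →L[ℝ] C(I, ℝ) :=
  LinearMap.mkContinuous
    { toFun := fun g => ⟨fun t => ∫ s in (0 : ℝ)..1, s ^ k * Set.IccExtend zero_le_one g (t * s), by
        have hg : Continuous (Set.IccExtend (zero_le_one (α := ℝ)) g) := g.continuous.Icc_extend'
        exact intervalIntegral.continuous_parametric_intervalIntegral_of_continuous'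
          (by fun_prop) 0 1⟩
      map_add' := fun g₁ g₂ => by
        ext t
        have h₁ : Continuous (Set.IccExtend (zero_le_one (α := ℝ)) g₁) := g₁.continuous.Icc_extend'
        have h₂ : Continuous (Set.IccExtend (zero_le_one (α := ℝ)) g₂) := g₂.continuous.Icc_extend'
        simp only [ContinuousMap.coe_mk, ContinuousMap.add_apply]
        rw [← intervalIntegral.integral_add (Continuous.intervalIntegrable (by fun_prop) _ _)
          (Continuous.intervalIntegrable (by fun_prop) _ _)]
        congr 1
        ext s
        simp only [Set.IccExtend, Function.comp, ContinuousMap.coe_add, Pi.add_apply]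
        ring
      map_smul' := fun c g => by
        ext t
        simp only [ContinuousMap.coe_mk, ContinuousMap.smul_apply, RingHom.id_apply, smul_eq_mul]
        rw [← intervalIntegral.integral_const_mul]
        congr 1
        ext s
        simp only [Set.IccExtend, Function.comp, ContinuousMap.coe_smul, Pi.smul_apply, smul_eq_mul]
        ring }
    1 fun g => by
      refine (ContinuousMap.norm_le _ (by positivity)).2 fun t => ?_
      refine (intervalIntegral.norm_integral_le_of_norm_le_const (C := 1 * ‖g‖) fun s hs => ?_).trans
        (by simp)
      rw [Set.uIoc_of_le zero_le_one] at hs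
      rw [norm_mul]
      gcongr
      · rw [norm_pow]
        exact pow_le_one₀ (norm_nonneg _) (by rw [Real.norm_of_nonneg hs.1.le]; exact hs.2)
      · exact g.norm_coe_le_norm _

theorem average_apply (k : ℕ) (g : C(I, ℝ)) (t : I) {u : ℝ → ℝ}
    (hu : ∀ s : I, g (t * s) = u s) :
    average k g t = ∫ s in (0 : ℝ)..1, s ^ k * u s := by
  refine intervalIntegral.integral_congr fun s hs => ?_
  rw [Set.uIcc_of_le zero_le_one] at hs
  have hmem : (t : ℝ) * s ∈ Set.Icc (0 : ℝ) 1 := (t * ⟨s, hs⟩ : I).2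
  rw [Set.IccExtend_of_mem _ _ hmem, ← hu ⟨s, hs⟩]
  rfl

section

variable {ι : Type*} [Fintype ι]

/-- Evaluation of a radius and a curve at the time `t`. -/
def evalPair (ι : Type*) [Fintype ι] (t : I) : ℝ × (ι → C(I, ℝ)) →L[ℝ] ℝ × (ι → ℝ) :=
  ((t : ℝ) • ContinuousLinearMap.fst ℝ ℝ (ι → C(I, ℝ))).prod
    (ContinuousLinearMap.pi fun i => (ContinuousMap.evalCLM ℝ t).comp
      ((ContinuousLinearMap.proj i).comp (ContinuousLinearMap.snd ℝ ℝ (ι → C(I, ℝ)))))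

theorem evalPair_apply (t : I) (z : ℝ × (ι → C(I, ℝ))) :
    evalPair ι t z = (z.1 * t, fun i => z.2 i t) := by
  ext <;> simp [evalPair, mul_comm]

theorem norm_evalPair_le (t : I) (z : ℝ × (ι → C(I, ℝ))) : ‖evalPair ι t z‖ ≤ ‖z‖ := by
  rw [evalPair_apply, Prod.norm_def, Prod.norm_def]
  refine max_le_max ?_ ?_
  · simp only [norm_mul]
    refine mul_le_of_le_one_right (norm_nonneg _) ?_
    rw [Real.norm_of_nonneg t.2.1]
    exact t.2.2
  · exact (pi_norm_le_iff_of_nonneg (norm_nonneg _)).2 fun i =>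
      ((z.2 i).norm_coe_le_norm t).trans (norm_le_pi_norm z.2 i)

theorem continuous_evalPair (z : ℝ × (ι → C(I, ℝ))) : Continuous fun t => evalPair ι t z := by
  simp only [evalPair_apply]
  fun_prop

/-- Evaluation of a radius, a curve and an auxiliary scalar curve at the time `t`. -/
def evalTriple (ι : Type*) [Fintype ι] (t : I) :
    (ℝ × (ι → C(I, ℝ))) × C(I, ℝ) →L[ℝ] (ℝ × (ι → ℝ)) × ℝ :=
  (evalPair ι t).prodMap (ContinuousMap.evalCLM ℝ t)

theorem evalTriple_apply (t : I) (z : (ℝ × (ι → C(I, ℝ))) × C(I, ℝ)) :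
    evalTriple ι t z = (evalPair ι t z.1, z.2 t) := rfl

theorem norm_evalTriple_le (t : I) (z : (ℝ × (ι → C(I, ℝ))) × C(I, ℝ)) :
    ‖evalTriple ι t z‖ ≤ ‖z‖ := by
  rw [evalTriple_apply, Prod.norm_def, Prod.norm_def]
  exact max_le_max (norm_evalPair_le t z.1) (z.2.norm_coe_le_norm t)

theorem continuous_evalTriple (z : (ℝ × (ι → C(I, ℝ))) × C(I, ℝ)) :
    Continuous fun t => evalTriple ι t z := by
  simp only [evalTriple_apply]
  exact (continuous_evalPair z.1).prodMk z.2.continuous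

/-- The weighted average of `h` along the curve `y`. -/
def massAverage (h : ℝ × (ι → ℝ) → ℝ) (κ : ℕ) (y : ℝ → ι → ℝ) (r : ℝ) : ℝ :=
  ∫ s in (0 : ℝ)..1, s ^ κ * h (r * s, y (r * s))

/-- The integral form, at the radius `r`, of the singular system
`r y_i' = -e_i (y_i - c_i) + r f_i(r, y, M)`, `r M' = -(κ + 1) M + h(r, y)`. -/
def IsSolAt (f : ι → (ℝ × (ι → ℝ)) × ℝ → ℝ) (h : ℝ × (ι → ℝ) → ℝ) (e : ι → ℕ) (κ : ℕ)
    (c : ι → ℝ) (y : ℝ → ι → ℝ) (r : ℝ) : Prop :=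
  ∀ i, y r i = c i + r * ∫ s in (0 : ℝ)..1,
    s ^ e i * f i ((r * s, y (r * s)), massAverage h κ y (r * s))

/-- The auxiliary scalar curve determined by a radius and a curve. -/
def massCurve (h : ℝ × (ι → ℝ) → ℝ) (κ : ℕ) (z : ℝ × (ι → C(I, ℝ))) : C(I, ℝ) :=
  average κ (nemytskii (evalPair ι) h z)

/-- The nonlinear integral operator whose fixed points are the rescaled solutions. -/
def solOp (f : ι → (ℝ × (ι → ℝ)) × ℝ → ℝ) (h : ℝ × (ι → ℝ) → ℝ) (e : ι → ℕ) (κ : ℕ)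
    (z : ℝ × (ι → C(I, ℝ))) : ι → C(I, ℝ) := fun i =>
  ⟨fun t : I => (t : ℝ), continuous_subtype_val⟩ *
    average (e i) (nemytskii (evalTriple ι) (f i) (z, massCurve h κ z))

/-- The constant curves. -/
def constCurve (ι : Type*) [Fintype ι] : (ι → ℝ) →L[ℝ] (ι → C(I, ℝ)) :=
  ContinuousLinearMap.pi fun i => (ContinuousLinearMap.toSpanSingleton ℝ (1 : C(I, ℝ))).comp
    (ContinuousLinearMap.proj i)

theorem constCurve_apply (c : ι → ℝ) (i : ι) (t : I) : constCurve ι c i t = c i := by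
  simp [constCurve]

variable {f : ι → (ℝ × (ι → ℝ)) × ℝ → ℝ} {h : ℝ × (ι → ℝ) → ℝ} {e : ι → ℕ} {κ : ℕ} {c₀ : ι → ℝ}

/-- At radius `0` a constant curve is seen at the same point from every `t`. This is why analyticity
of `h` and `f` at one point suffices for the operators on curves. -/
theorem evalPair_const (t : I) : evalPair ι t (0, constCurve ι c₀) = (0, c₀) := by
  rw [evalPair_apply]
  ext <;> simp [constCurve_apply]

theorem analyticAt_massCurve (hh : AnalyticAt ℝ h (0, c₀)) :
    AnalyticAt ℝ (massCurve h κ) (0, constCurve ι c₀) :=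
  (average κ).analyticAt _ |>.comp
    (analyticAt_nemytskii norm_evalPair_le continuous_evalPair evalPair_const hh)

/-- The factor is `∫₀¹ s^κ ds = 1 / (κ + 1)`. It is the value of `M` forced at the origin by `r M' =
-(κ + 1) M + h`, hence the base point at which `f` must be analytic. -/
theorem massCurve_const (hh : AnalyticAt ℝ h (0, c₀)) (t : I) :
    massCurve h κ (0, constCurve ι c₀) t = h (0, c₀) / (κ + 1) := by
  have := (eventually_nemytskii_apply norm_evalPair_le continuous_evalPair
    (evalPair_const (c₀ := c₀)) hh).self_of_nhds
  rw [massCurve, average_apply (u := fun _ => h (0, c₀)) κ _ t fun s => by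
    rw [(this (t * s)).2, evalPair_const]]
  rw [intervalIntegral.integral_mul_const, integral_pow]
  simp
  ring

theorem evalTriple_const (hh : AnalyticAt ℝ h (0, c₀)) (t : I) :
    evalTriple ι t ((0, constCurve ι c₀), massCurve h κ (0, constCurve ι c₀))
      = ((0, c₀), h (0, c₀) / (κ + 1)) := by
  rw [evalTriple_apply, massCurve_const hh, evalPair_const]

theorem analyticAt_solOp (hh : AnalyticAt ℝ h (0, c₀))
    (hf : ∀ i, AnalyticAt ℝ (f i) ((0, c₀), h (0, c₀) / (κ + 1))) :
    AnalyticAt ℝ (solOp f h e κ) (0, constCurve ι c₀) := by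
  refine AnalyticAt.pi fun i => analyticAt_const.mul ?_
  refine ((average (e i)).analyticAt _).comp ?_
  exact (analyticAt_nemytskii norm_evalTriple_le continuous_evalTriple
    (evalTriple_const hh) (hf i)).comp (f := fun z => (z, massCurve h κ z))
    (analyticAt_id.prod (analyticAt_massCurve hh))

/-- The pointwise description of the operators, on the pairs `z = (r, x)` near a constant curve:
`x` is the rescaling of a curve `y` defined on the segment from `0` to `r`. -/
theorem eventually_solOp_apply (hh : AnalyticAt ℝ h (0, c₀))
    (hf : ∀ i, AnalyticAt ℝ (f i) ((0, c₀), h (0, c₀) / (κ + 1))) :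
    ∀ᶠ z in 𝓝 ((0 : ℝ), constCurve ι c₀), ∀ y : ℝ → ι → ℝ,
      (∀ (t : I) (i : ι), z.2 i t = y (z.1 * t) i) → ∀ t : I,
        massCurve h κ z t = massAverage h κ y (z.1 * t) ∧
        AnalyticAt ℝ h (z.1 * t, y (z.1 * t)) ∧
        ∀ i, AnalyticAt ℝ (f i) ((z.1 * t, y (z.1 * t)), massAverage h κ y (z.1 * t)) ∧
          solOp f h e κ z i t = t * ∫ s in (0 : ℝ)..1, s ^ e i *
            f i ((z.1 * t * s, y (z.1 * t * s)), massAverage h κ y (z.1 * t * s)) := by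
  have h1 := eventually_nemytskii_apply norm_evalPair_le continuous_evalPair
    (evalPair_const (c₀ := c₀)) hh
  have hcont : ContinuousAt (fun z => (z, massCurve h κ z)) ((0 : ℝ), constCurve ι c₀) :=
    continuousAt_id.prodMk (analyticAt_massCurve hh).continuousAt
  have h2 : ∀ᶠ z in 𝓝 ((0 : ℝ), constCurve ι c₀), ∀ i, ∀ t : I, _ :=
    eventually_all.2 fun i => hcont.eventually (eventually_nemytskii_apply norm_evalTriple_le
      continuous_evalTriple (evalTriple_const hh) (hf i))
  filter_upwards [h1, h2] with z hz1 hz2 y hy t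
  have he : ∀ t : I, evalPair ι t z = (z.1 * t, y (z.1 * t)) := fun t => by
    rw [evalPair_apply]
    simp [hy]
  have hm : ∀ t : I, massCurve h κ z t = massAverage h κ y (z.1 * t) := fun t => by
    refine average_apply κ _ t fun s => ?_
    rw [(hz1 _).2, he]
    simp [mul_assoc]
  refine ⟨hm t, ?_, fun i => ⟨?_, ?_⟩⟩
  · have := (hz1 t).1
    rwa [he] at this
  · have := (hz2 i t).1
    rwa [evalTriple_apply, he, hm] at this
  · rw [solOp, ContinuousMap.mul_apply]
    congr 1
    refine average_apply (e i) _ t fun s => ?_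
    rw [(hz2 i _).2, evalTriple_apply, he, hm]
    simp [mul_assoc]

end

end

/-! ### Local solutions of the singular system. -/

section

open Filter Topology
open scoped unitInterval ENNReal NNReal

section

variable {ι : Type*} [Fintype ι]
variable {f : ι → (ℝ × (ι → ℝ)) × ℝ → ℝ} {h : ℝ × (ι → ℝ) → ℝ} {e : ι → ℕ} {κ : ℕ} {c₀ : ι → ℝ}

theorem continuous_constCurve_prod :
    Continuous fun z : ℝ × (ι → ℝ) => (z.1, constCurve ι z.2) := by fun_prop

theorem norm_sub_constCurve_le {x : ι → C(I, ℝ)} {c : ι → ℝ} {δ : ℝ} (hδ : 0 ≤ δ)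
    (hx : ∀ t i, |x i t - c i| ≤ δ) : ‖x - constCurve ι c‖ ≤ δ := by
  refine (pi_norm_le_iff_of_nonneg hδ).2 fun i => (ContinuousMap.norm_le _ hδ).2 fun t => ?_
  simpa [constCurve_apply] using hx t i

/-- Local existence, analytic dependence on the radius and on the initial values, and uniqueness for
the singular system. -/
theorem exists_local_solution (hh : AnalyticAt ℝ h (0, c₀))
    (hf : ∀ i, AnalyticAt ℝ (f i) ((0, c₀), h (0, c₀) / (κ + 1))) :
    ∃ Y : ℝ × (ι → ℝ) → ι → ℝ, ∃ ε > 0,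
      (∀ z ∈ Metric.ball ((0 : ℝ), c₀) ε, AnalyticAt ℝ Y z ∧
        AnalyticAt ℝ (fun z => massAverage h κ (fun r => Y (r, z.2)) z.1) z ∧
        AnalyticAt ℝ h (z.1, Y z) ∧
        (∀ i, AnalyticAt ℝ (f i) ((z.1, Y z), massAverage h κ (fun r => Y (r, z.2)) z.1)) ∧
        IsSolAt f h e κ z.2 (fun r => Y (r, z.2)) z.1) ∧
      ∀ y : ℝ → ι → ℝ, (∀ᶠ x in 𝓝 0, ContinuousAt y x) → y 0 = c₀ →
        (∀ᶠ r in 𝓝 0, IsSolAt f h e κ c₀ y r) → ∀ᶠ r in 𝓝 0, y r = Y (r, c₀) := by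
  obtain ⟨S, hS, hS₀, hfix, hinv⟩ :=
    exists_analyticAt_fixedPoint (analyticAt_solOp (e := e) hh hf)
  obtain ⟨δ, hδ, hgood⟩ := Metric.eventually_nhds_iff_ball.1
    ((eventually_solOp_apply (e := e) hh hf).and hinv)
  -- a curve close to a constant which solves the integral equation is the value of `S`
  have huniq : ∀ (r : ℝ) (x : ι → C(I, ℝ)) (c : ι → ℝ) (y : ℝ → ι → ℝ),
      (r, x) ∈ Metric.ball ((0 : ℝ), constCurve ι c₀) δ → (∀ (t : I) i, x i t = y (r * t) i) →
      (∀ t : I, IsSolAt f h e κ c y (r * t)) → S (r, constCurve ι c) = x := by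
    intro r x c y hx hxy hsol
    obtain ⟨h1, h2⟩ := hgood _ hx
    have : x - r • solOp f h e κ (r, x) = constCurve ι c := by
      ext i t
      rw [constCurve_apply]
      simp only [Pi.sub_apply, Pi.smul_apply, ContinuousMap.sub_apply, ContinuousMap.smul_apply,
        smul_eq_mul]
      rw [((h1 y hxy t).2.2 i).2, hxy, hsol t i]
      ring
    rw [← this]
    exact h2
  let Φ : ℝ × (ι → ℝ) → ℝ × (ι → C(I, ℝ)) := fun z => (z.1, constCurve ι z.2)
  have hΦan : ∀ z, AnalyticAt ℝ Φ z := fun z =>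
    analyticAt_fst.prod (((constCurve ι).analyticAt _).comp analyticAt_snd)
  have hΦ : Tendsto Φ (𝓝 (0, c₀)) (𝓝 (0, constCurve ι c₀)) :=
    continuous_constCurve_prod.tendsto' _ _ rfl
  let Ψ : ℝ × (ι → ℝ) → ℝ × (ι → C(I, ℝ)) := fun z => (z.1, S (Φ z))
  have hSΦ : ContinuousAt (fun z => S (Φ z)) (0, c₀) :=
    ContinuousAt.comp (f := Φ) hS.continuousAt (hΦan _).continuousAt
  have hΨ : Tendsto Ψ (𝓝 (0, c₀)) (𝓝 (0, constCurve ι c₀)) := by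
    have : ContinuousAt Ψ (0, c₀) := continuousAt_fst.prodMk hSΦ
    have h2 : Ψ (0, c₀) = (0, constCurve ι c₀) := Prod.ext rfl hS₀
    rw [ContinuousAt, h2] at this
    exact this
  obtain ⟨ε, hε, hball⟩ := Metric.eventually_nhds_iff_ball.1
    (((hΨ.eventually (Metric.ball_mem_nhds _ hδ)).and (hΦ.eventually hfix)).and
      ((hΦ.eventually hS.eventually_analyticAt).and
        (hΨ.eventually (analyticAt_massCurve (κ := κ) hh).eventually_analyticAt)))
  let Y : ℝ × (ι → ℝ) → ι → ℝ := fun z i => S (Φ z) i 1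
  -- the rescaling property
  have hscale : ∀ z ∈ Metric.ball ((0 : ℝ), c₀) ε, ∀ (s : I) i,
      S (Φ z) i s = Y (z.1 * s, z.2) i := by
    rintro ⟨r, c⟩ hz s i
    obtain ⟨⟨hz1, hz2⟩, -⟩ := hball _ hz
    change S (r, constCurve ι c) - r • solOp f h e κ (r, S (r, constCurve ι c)) = constCurve ι c
      at hz2
    change (r, S (r, constCurve ι c)) ∈ Metric.ball ((0 : ℝ), constCurve ι c₀) δ at hz1
    change S (r, constCurve ι c) i s = S (r * s, constCurve ι c) i 1
    -- Undoing the rescaling divides by `r`; at `r = 0` the fixed point is the constant curve.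
    rcases eq_or_ne r 0 with rfl | hr
    · rw [zero_smul, sub_zero] at hz2
      simp only [zero_mul]
      rw [hz2, constCurve_apply, constCurve_apply]
    set x := S (r, constCurve ι c) with hxdef
    -- The curve on the segment from `0` to `r` whose rescaling is `x`. Its values beyond the
    -- segment play no role.
    let y : ℝ → ι → ℝ := fun τ i => Set.IccExtend (zero_le_one (α := ℝ)) (x i) (τ / r)
    have hy : ∀ (t : I) i, x i t = y (r * t) i := fun t i => by
      simp only [y]
      rw [mul_div_cancel_left₀ _ hr, Set.IccExtend_of_mem _ _ t.2]
    have hsol : ∀ t : I, IsSolAt f h e κ c y (r * t) := fun t i => by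
      have h1 := (((hgood _ hz1).1 y hy t).2.2 i).2
      have h2 := congrArg (fun g : ι → C(I, ℝ) => g i t) hz2
      simp only [Pi.sub_apply, Pi.smul_apply, ContinuousMap.sub_apply, ContinuousMap.smul_apply,
        smul_eq_mul, constCurve_apply] at h2
      rw [h1] at h2
      rw [← hy]
      linear_combination h2
    -- The restriction of the same curve to the segment up to `r s`, rescaled, is `t ↦ x (s t)`. It
    -- also solves the equation, so uniqueness identifies it with the fixed point at radius `r s`;
    -- evaluating at `t = 1` gives the claim.
    have hx1 := huniq (r * s) (fun i => (x i).comp ⟨fun t => s * t, by fun_prop⟩) c y ?_ ?_ ?_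
    · rw [hx1]
      simp
    · rw [mem_ball_iff_norm, Prod.norm_def, max_lt_iff] at hz1 ⊢
      refine ⟨?_, ?_⟩
      · have : ‖r - 0‖ < δ := hz1.1
        rw [sub_zero] at this
        change ‖r * s - 0‖ < δ
        rw [sub_zero, norm_mul]
        refine (mul_le_of_le_one_right (norm_nonneg _) ?_).trans_lt this
        rw [Real.norm_of_nonneg s.2.1]
        exact s.2.2
      · refine lt_of_le_of_lt (norm_sub_constCurve_le (norm_nonneg _) fun t i => ?_) hz1.2
        have h1 := (((x - constCurve ι c₀) i).norm_coe_le_norm (s * t)).trans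
          (norm_le_pi_norm (x - constCurve ι c₀) i)
        simpa [constCurve_apply] using h1
    · intro t i
      rw [mul_assoc]
      exact hy (s * t) i
    · intro t
      rw [mul_assoc]
      exact hsol (s * t)
  have hkey : ∀ z ∈ Metric.ball ((0 : ℝ), c₀) ε,
      massCurve h κ (Ψ z) 1 = massAverage h κ (fun r => Y (r, z.2)) z.1 ∧
      AnalyticAt ℝ h (z.1, Y z) ∧
      (∀ i, AnalyticAt ℝ (f i) ((z.1, Y z), massAverage h κ (fun r => Y (r, z.2)) z.1)) ∧
      IsSolAt f h e κ z.2 (fun r => Y (r, z.2)) z.1 := by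
    intro z hz
    obtain ⟨⟨hz1, hz2⟩, -⟩ := hball _ hz
    obtain ⟨h1, h2, h3⟩ := (hgood _ hz1).1 (fun r => Y (r, z.2)) (hscale z hz) 1
    have hz1' : (Ψ z).1 * ((1 : I) : ℝ) = z.1 := by simp [Ψ]
    rw [hz1'] at h1 h2 h3
    refine ⟨h1, h2, fun i => (h3 i).1, fun i => ?_⟩
    have h4 := congrArg (fun g : ι → C(I, ℝ) => g i 1) hz2
    simp only [Pi.sub_apply, Pi.smul_apply, ContinuousMap.sub_apply, ContinuousMap.smul_apply,
      smul_eq_mul] at h4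
    have h5 := (h3 i).2
    simp only [Ψ] at h5
    have h6 : (Φ z).1 = z.1 := rfl
    rw [h6, h5] at h4
    have h7 : (Φ z).2 i 1 = z.2 i := constCurve_apply _ _ _
    rw [h7] at h4
    simp only [Set.Icc.coe_one, one_mul] at h4
    change S (Φ z) i 1 = _
    linear_combination h4
  refine ⟨Y, ε, hε, fun z hz => ?_, ?_⟩
  · obtain ⟨-, hz3, hz4⟩ := hball _ hz
    have hSan : AnalyticAt ℝ (fun z => S (Φ z)) z := hz3.comp (hΦan z)
    refine ⟨?_, ?_, (hkey z hz).2.1, (hkey z hz).2.2.1, (hkey z hz).2.2.2⟩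
    · refine AnalyticAt.pi fun i => ?_
      exact ((ContinuousMap.evalCLM ℝ (1 : I)).analyticAt _).comp
        (((ContinuousLinearMap.proj (R := ℝ) (φ := fun _ : ι => C(I, ℝ)) i).analyticAt _).comp hSan)
    · have h1 : AnalyticAt ℝ (fun z => massCurve h κ (Ψ z) 1) z :=
        AnalyticAt.comp (g := ContinuousMap.evalCLM ℝ (1 : I))
          (f := fun z => massCurve h κ (Ψ z)) (ContinuousLinearMap.analyticAt _ _)
          (AnalyticAt.comp (f := Ψ) hz4 (analyticAt_fst.prod hSan))
      refine h1.congr ?_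
      filter_upwards [Metric.isOpen_ball.mem_nhds hz] with w hw using (hkey w hw).1
  · intro y hyc hy0 hysol
    have hyc0 : ∀ᶠ x in 𝓝 (0 : ℝ), ‖y x - c₀‖ < δ / 2 := by
      have := hyc.self_of_nhds
      rw [ContinuousAt, hy0] at this
      simpa [dist_eq_norm] using this.eventually (Metric.ball_mem_nhds _ (half_pos hδ))
    obtain ⟨r₀, hr₀, hr₀'⟩ := Metric.eventually_nhds_iff_ball.1 (hyc.and (hysol.and hyc0))
    filter_upwards [Metric.ball_mem_nhds (0 : ℝ) hr₀, Metric.ball_mem_nhds (0 : ℝ) hδ] with r hr hrδ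
    have hseg : ∀ t : I, r * t ∈ Metric.ball (0 : ℝ) r₀ := fun t => by
      rw [mem_ball_zero_iff] at hr ⊢
      rw [norm_mul]
      refine (mul_le_of_le_one_right (norm_nonneg _) ?_).trans_lt hr
      rw [Real.norm_of_nonneg t.2.1]
      exact t.2.2
    have hcont : Continuous fun t : I => y (r * t) :=
      continuous_iff_continuousAt.2 fun t =>
        ContinuousAt.comp (f := fun t : I => r * (t : ℝ)) (hr₀' _ (hseg t)).1
          (by fun_prop)
    have := huniq r (fun i => ⟨fun t => y (r * t) i, (continuous_apply i).comp hcont⟩) c₀ y ?_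
      (fun t i => rfl) (fun t => (hr₀' _ (hseg t)).2.1)
    · ext i
      change y r i = S (r, constCurve ι c₀) i 1
      rw [this]
      simp
    · rw [mem_ball_iff_norm, Prod.norm_def, max_lt_iff]
      refine ⟨by simpa using hrδ, ?_⟩
      refine (norm_sub_constCurve_le (half_pos hδ).le fun t i => ?_).trans_lt (half_lt_self hδ)
      exact (norm_le_pi_norm (y (r * t) - c₀) i).trans (hr₀' _ (hseg t)).2.2.le

end

end

/-! ### Gluing over all parameters, and the return to differential equations. -/

section

open Filter Topology
open scoped unitInterval ENNReal NNReal

section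

variable {ι : Type*} [Fintype ι]
variable {f : ι → (ℝ × (ι → ℝ)) × ℝ → ℝ} {h : ℝ × (ι → ℝ) → ℝ} {e : ι → ℕ} {κ : ℕ}

omit [Fintype ι] in
theorem massAverage_congr {y₁ y₂ : ℝ → ι → ℝ} {r : ℝ}
    (hy : ∀ s : I, y₁ (r * s) = y₂ (r * s)) :
    massAverage h κ y₁ r = massAverage h κ y₂ r := by
  refine intervalIntegral.integral_congr fun s hs => ?_
  rw [Set.uIcc_of_le zero_le_one] at hs
  rw [hy ⟨s, hs⟩]

omit [Fintype ι] in
theorem IsSolAt.congr {c : ι → ℝ} {y₁ y₂ : ℝ → ι → ℝ} {r : ℝ}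
    (hs : IsSolAt f h e κ c y₁ r) (hy : ∀ s : I, y₁ (r * s) = y₂ (r * s)) :
    IsSolAt f h e κ c y₂ r := by
  intro i
  have h1 := hy 1
  simp only [Set.Icc.coe_one, mul_one] at h1
  rw [← h1, hs i]
  congr 2
  refine intervalIntegral.integral_congr fun s hs => ?_
  rw [Set.uIcc_of_le zero_le_one] at hs
  rw [hy ⟨s, hs⟩, massAverage_congr (y₁ := y₁) (y₂ := y₂) fun t => ?_]
  have := hy (⟨s, hs⟩ * t)
  simpa [mul_assoc] using this

/-- The solutions of the singular system, for all values of the parameters at once. -/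
theorem exists_solution {Q : Type*} [NormedAddCommGroup Q] [NormedSpace ℝ Q] {c : Q → ι → ℝ}
    (hc : ∀ p, AnalyticAt ℝ c p) (hh : ∀ p, AnalyticAt ℝ h (0, c p))
    (hf : ∀ p i, AnalyticAt ℝ (f i) ((0, c p), h (0, c p) / (κ + 1))) :
    ∃ U : Set (ℝ × Q), ∃ Y : ℝ × Q → ι → ℝ, IsOpen U ∧ (∀ p, ((0 : ℝ), p) ∈ U) ∧
      ∀ z ∈ U, (∀ s : I, (z.1 * s, z.2) ∈ U) ∧ AnalyticAt ℝ Y z ∧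
        AnalyticAt ℝ (fun z => massAverage h κ (fun r => Y (r, z.2)) z.1) z ∧
        AnalyticAt ℝ h (z.1, Y z) ∧
        (∀ i, AnalyticAt ℝ (f i) ((z.1, Y z), massAverage h κ (fun r => Y (r, z.2)) z.1)) ∧
        IsSolAt f h e κ (c z.2) (fun r => Y (r, z.2)) z.1 := by
  have hloc : ∀ p₀, ∃ Y : ℝ × Q → ι → ℝ, ∃ ε > 0,
      (∀ z ∈ Metric.ball ((0 : ℝ), p₀) ε, AnalyticAt ℝ Y z ∧
        AnalyticAt ℝ (fun z => massAverage h κ (fun r => Y (r, z.2)) z.1) z ∧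
        AnalyticAt ℝ h (z.1, Y z) ∧
        (∀ i, AnalyticAt ℝ (f i) ((z.1, Y z), massAverage h κ (fun r => Y (r, z.2)) z.1)) ∧
        IsSolAt f h e κ (c z.2) (fun r => Y (r, z.2)) z.1) := by
    intro p₀
    obtain ⟨Y, ε, hε, hY, -⟩ := exists_local_solution (e := e) (hh p₀) (hf p₀)
    have hcan : ∀ z : ℝ × Q, AnalyticAt ℝ (fun z : ℝ × Q => (z.1, c z.2)) z := fun z =>
      analyticAt_fst.prod (AnalyticAt.comp (hc z.2) analyticAt_snd)
    obtain ⟨δ, hδ, hball⟩ := Metric.eventually_nhds_iff_ball.1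
      ((hcan (0, p₀)).continuousAt.eventually (Metric.ball_mem_nhds _ hε))
    refine ⟨fun z => Y (z.1, c z.2), δ, hδ, fun z hz => ?_⟩
    obtain ⟨h1, h2, h3, h4, h5⟩ := hY _ (hball z hz)
    exact ⟨AnalyticAt.comp (f := fun z : ℝ × Q => (z.1, c z.2)) h1 (hcan z),
      AnalyticAt.comp (f := fun z : ℝ × Q => (z.1, c z.2)) h2 (hcan z), h3, h4, h5⟩
  choose Y ε hε hY using hloc
  have hseg : ∀ p₀, ∀ z ∈ Metric.ball ((0 : ℝ), p₀) (ε p₀), ∀ s : I,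
      (z.1 * s, z.2) ∈ Metric.ball ((0 : ℝ), p₀) (ε p₀) := by
    intro p₀ z hz s
    rw [mem_ball_iff_norm, Prod.norm_def, max_lt_iff] at hz ⊢
    refine ⟨?_, hz.2⟩
    have h1 : ‖z.1 - 0‖ < ε p₀ := hz.1
    change ‖z.1 * s - 0‖ < ε p₀
    rw [sub_zero] at h1 ⊢
    rw [norm_mul]
    refine (mul_le_of_le_one_right (norm_nonneg _) ?_).trans_lt h1
    rw [Real.norm_of_nonneg s.2.1]
    exact s.2.2
  have hz0 : ∀ p₀, ∀ z ∈ Metric.ball ((0 : ℝ), p₀) (ε p₀), (0, z.2) ∈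
      Metric.ball ((0 : ℝ), p₀) (ε p₀) := fun p₀ z hz => by simpa using hseg p₀ z hz 0
  -- the local solutions agree wherever they are both defined
  have hagree : ∀ p₀ p₁ z, z ∈ Metric.ball ((0 : ℝ), p₀) (ε p₀) →
      z ∈ Metric.ball ((0 : ℝ), p₁) (ε p₁) → Y p₀ z = Y p₁ z := by
    rintro p₀ p₁ ⟨r, p⟩ h0 h1
    -- Uniqueness is available only at the centre `c₀` of a local solution. Both candidates are
    -- therefore compared near `r = 0` with the solution centred at `c p` itself.
    obtain ⟨Z, η, hη, -, hZ⟩ := exists_local_solution (e := e) (hh p) (hf p)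
    have hopen : ∀ q, IsOpen {x : ℝ | (x, p) ∈ Metric.ball ((0 : ℝ), q) (ε q)} := fun q =>
      Metric.isOpen_ball.preimage (by fun_prop)
    have han : ∀ q x, (x, p) ∈ Metric.ball ((0 : ℝ), q) (ε q) →
        AnalyticAt ℝ (fun x => Y q (x, p)) x := fun q x hx =>
      AnalyticAt.comp (f := fun x : ℝ => (x, p)) (hY q _ hx).1 (analyticAt_id.prod analyticAt_const)
    have hq : ∀ q, (r, p) ∈ Metric.ball ((0 : ℝ), q) (ε q) →
        ∀ᶠ x in 𝓝 0, Y q (x, p) = Z (x, c p) := by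
      intro q hq
      have hmem := (hopen q).mem_nhds (hz0 q _ hq)
      refine hZ (fun x => Y q (x, p)) ?_ ?_ ?_
      · filter_upwards [hmem] with x hx using (han q x hx).continuousAt
      · ext i
        have := (hY q _ (hz0 q _ hq)).2.2.2.2 i
        simpa using this
      · filter_upwards [hmem] with x hx using (hY q _ hx).2.2.2.2
    have hev : (fun x => Y p₀ (x, p)) =ᶠ[𝓝 0] fun x => Y p₁ (x, p) := by
      filter_upwards [hq p₀ h0, hq p₁ h1] with x hx0 hx1
      rw [hx0, hx1]
    let V : Set ℝ := segment ℝ 0 r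
    have hV : ∀ x ∈ V, ∀ q, (r, p) ∈ Metric.ball ((0 : ℝ), q) (ε q) →
        (x, p) ∈ Metric.ball ((0 : ℝ), q) (ε q) := by
      intro x hx q hq
      simp only [V, segment_eq_image, smul_eq_mul, mul_zero, zero_add] at hx
      obtain ⟨s, hs, rfl⟩ := hx
      rw [show (fun a => a * r) s = r * s from mul_comm s r]
      exact hseg q _ hq ⟨s, hs⟩
    -- Agreement near `0` spreads along the segment to `r` by the identity theorem.
    exact AnalyticOnNhd.eqOn_of_preconnected_of_eventuallyEq
      (fun x hx => han p₀ x (hV x hx p₀ h0)) (fun x hx => han p₁ x (hV x hx p₁ h1))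
      (convex_segment 0 r).isPreconnected (left_mem_segment ℝ 0 r) hev (right_mem_segment ℝ 0 r)
  let U : Set (ℝ × Q) := ⋃ p₀, Metric.ball ((0 : ℝ), p₀) (ε p₀)
  classical
  let W : ℝ × Q → ι → ℝ := fun z =>
    if hz : ∃ p₀, z ∈ Metric.ball ((0 : ℝ), p₀) (ε p₀) then Y hz.choose z else 0
  have hW : ∀ p₀, ∀ z ∈ Metric.ball ((0 : ℝ), p₀) (ε p₀), W z = Y p₀ z := by
    intro p₀ z hz
    have hex : ∃ p₀, z ∈ Metric.ball ((0 : ℝ), p₀) (ε p₀) := ⟨p₀, hz⟩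
    simp only [W, dif_pos hex]
    exact hagree _ _ z hex.choose_spec hz
  refine ⟨U, W, isOpen_iUnion fun _ => Metric.isOpen_ball,
    fun p => Set.mem_iUnion.2 ⟨p, Metric.mem_ball_self (hε p)⟩, fun z hz => ?_⟩
  obtain ⟨p₀, hz⟩ := Set.mem_iUnion.1 hz
  have hWs : ∀ w ∈ Metric.ball ((0 : ℝ), p₀) (ε p₀), ∀ s : I,
      Y p₀ (w.1 * s, w.2) = W (w.1 * s, w.2) := fun w hw s => (hW p₀ _ (hseg p₀ w hw s)).symm
  have hmass : ∀ w ∈ Metric.ball ((0 : ℝ), p₀) (ε p₀),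
      massAverage h κ (fun r => Y p₀ (r, w.2)) w.1 = massAverage h κ (fun r => W (r, w.2)) w.1 :=
    fun w hw => massAverage_congr (hWs w hw)
  obtain ⟨h1, h2, h3, h4, h5⟩ := hY p₀ z hz
  have hnhds := Metric.isOpen_ball.mem_nhds hz
  refine ⟨fun s => Set.mem_iUnion.2 ⟨p₀, hseg p₀ z hz s⟩, h1.congr ?_, h2.congr ?_, ?_, ?_,
    h5.congr (hWs z hz)⟩
  · filter_upwards [hnhds] with w hw using (hW p₀ w hw).symm
  · filter_upwards [hnhds] with w hw using hmass w hw
  · rwa [hW p₀ z hz]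
  · intro i
    rw [hW p₀ z hz, ← hmass z hz]
    exact h4 i

/-- The derivative of a weighted average over the segment from `0` to `r`. -/
theorem hasDerivAt_average {φ : ℝ → ℝ} {k : ℕ} {r : ℝ} (hr : r ≠ 0)
    (hφ : ∀ s : I, ContinuousAt φ (r * s)) (hφ' : ∀ᶠ x in 𝓝 r, ContinuousAt φ x) :
    HasDerivAt (fun x => ∫ s in (0 : ℝ)..1, s ^ k * φ (x * s))
      ((φ r - (k + 1) * ∫ s in (0 : ℝ)..1, s ^ k * φ (r * s)) / r) r := by
  -- The substitution `u = x s` moves the dependence on `x` out of the integrand, so only continuity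
  -- of `φ` is needed to differentiate.
  have hA : ∀ x : ℝ, x ≠ 0 → ∫ s in (0 : ℝ)..1, s ^ k * φ (x * s)
      = (∫ u in (0 : ℝ)..x, u ^ k * φ u) / x ^ (k + 1) := by
    intro x hx
    have h1 := intervalIntegral.integral_comp_mul_left (a := 0) (b := 1)
      (fun u => u ^ k * φ u) hx
    simp only [mul_zero, mul_one, smul_eq_mul] at h1
    have h2 : ∫ s in (0 : ℝ)..1, (x * s) ^ k * φ (x * s)
        = x ^ k * ∫ s in (0 : ℝ)..1, s ^ k * φ (x * s) := by
      rw [← intervalIntegral.integral_const_mul]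
      congr 1
      ext s
      ring
    rw [h2] at h1
    field_simp
    rw [pow_succ]
    field_simp at h1
    linear_combination h1
  have hcont : ContinuousOn φ (Set.uIcc 0 r) := by
    intro x hx
    rw [← segment_eq_uIcc, segment_eq_image] at hx
    simp only [smul_eq_mul, mul_zero, zero_add] at hx
    obtain ⟨s, hs, rfl⟩ := hx
    rw [show (fun a => a * r) s = r * s from mul_comm s r]
    exact (hφ ⟨s, hs⟩).continuousWithinAt
  have hrc : ContinuousAt φ r := hφ'.self_of_nhds
  obtain ⟨V, hV, hVo, hrV⟩ := eventually_nhds_iff.1 hφ'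
  have hF : HasDerivAt (fun x => ∫ u in (0 : ℝ)..x, u ^ k * φ u) (r ^ k * φ r) r := by
    refine intervalIntegral.integral_hasDerivAt_right ?_ ?_ ?_
    · exact ContinuousOn.intervalIntegrable (by fun_prop)
    · refine ContinuousOn.stronglyMeasurableAtFilter hVo (fun x hx => ?_) r hrV
      have := hV x hx
      exact ContinuousAt.continuousWithinAt (by fun_prop)
    · fun_prop
  have h3 := hF.div (hasDerivAt_pow (k + 1) r) (pow_ne_zero _ hr)
  refine (h3.congr_of_eventuallyEq ?_).congr_deriv ?_
  · filter_upwards [isOpen_ne.mem_nhds hr] with x hx using hA x hx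
  · rw [hA r hr]
    push_cast
    field_simp
    ring

omit [Fintype ι] in
/-- Solutions of the integral equation solve the singular system of differential equations. -/
theorem hasDerivAt_of_isSolAt {c : ι → ℝ} {y : ℝ → ι → ℝ} {r : ℝ} (hr : r ≠ 0)
    (hsol : ∀ᶠ x in 𝓝 r, IsSolAt f h e κ c y x)
    (hcont : ∀ i, ∀ s : I, ContinuousAt (fun x => f i ((x, y x), massAverage h κ y x)) (r * s))
    (hcont' : ∀ i, ∀ᶠ x in 𝓝 r, ContinuousAt (fun x => f i ((x, y x), massAverage h κ y x)) x)
    (i : ι) :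
    HasDerivAt (fun x => y x i)
      (f i ((r, y r), massAverage h κ y r) - e i * (y r i - c i) / r) r := by
  have h1 := hasDerivAt_average (k := e i) hr (hcont i) (hcont' i)
  have h2 := ((hasDerivAt_id r).mul h1).const_add (c i)
  refine (h2.congr_of_eventuallyEq ?_).congr_deriv ?_
  · filter_upwards [hsol] with x hx using hx i
  · rw [hsol.self_of_nhds i]
    simp only [id_eq]
    field_simp
    ring

end

end

section

open Polynomial

/-! ### Hahn polynomials -/

/-- The coefficient of `(-x)_i` in the Hahn polynomial. -/
def hahnCoeff (N k i : ℕ) : ℝ :=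
  (ascPochhammer ℝ i).eval (-(k : ℝ)) * (ascPochhammer ℝ i).eval ((k : ℝ) + 1)
    / ((ascPochhammer ℝ i).eval 2 * (ascPochhammer ℝ i).eval (-((N : ℝ) - 1)) * (i.factorial : ℝ))

theorem hahn_eq_sum (N k : ℕ) (x : ℝ) :
    hahn N k x = ∑ i ∈ Finset.range (k + 1), hahnCoeff N k i * (ascPochhammer ℝ i).eval (-x) :=
  Finset.sum_congr rfl fun i _ => by rw [hahnCoeff]; ring

theorem ascPochhammer_eval_ne_zero {a : ℝ} {n : ℕ} (h : ∀ i < n, a + i ≠ 0) :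
    (ascPochhammer ℝ n).eval a ≠ 0 := by
  induction n with
  | zero => simp
  | succ n ih =>
    rw [ascPochhammer_succ_eval]
    exact mul_ne_zero (ih fun i hi => h i (by omega)) (h n (by omega))

theorem ascPochhammer_neg_sub_ne_zero {N i : ℕ} (hi : i + 1 ≤ N) :
    (ascPochhammer ℝ i).eval (-((N : ℝ) - 1)) ≠ 0 := by
  refine ascPochhammer_eval_ne_zero fun m hm h => ?_
  have : (m : ℝ) + 1 < N := by exact_mod_cast (by omega : m + 1 < N)
  linarith

theorem ascPochhammer_two_ne_zero (i : ℕ) : (ascPochhammer ℝ i).eval 2 ≠ 0 :=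
  ascPochhammer_eval_ne_zero fun m _ => by positivity

/-- The term ratio of the hypergeometric series. The bound on `i` keeps the Pochhammer symbol of
`-(N - 1)` in the denominator away from zero. -/
theorem hahnCoeff_succ {N k i : ℕ} (hi : i + 2 ≤ N) :
    hahnCoeff N k (i + 1) * ((i + 1) * (i + 2) * (i - ((N : ℝ) - 1)))
      = hahnCoeff N k i * ((i - k) * (i + k + 1)) := by
  have h1 := ascPochhammer_neg_sub_ne_zero (N := N) (i := i) (by omega)
  have h2 := ascPochhammer_two_ne_zero i
  have h3 : (i : ℝ) - ((N : ℝ) - 1) ≠ 0 := by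
    have : (i : ℝ) + 2 ≤ N := by exact_mod_cast hi
    intro h
    linarith
  have h3' : -((N : ℝ) - 1) + i ≠ 0 := by
    contrapose! h3
    linarith
  have h4 : (2 : ℝ) + i ≠ 0 := by positivity
  have h5 : ((i.factorial : ℕ) : ℝ) ≠ 0 := by positivity
  have h6 : (i : ℝ) + 1 ≠ 0 := by positivity
  simp only [hahnCoeff, ascPochhammer_succ_eval, Nat.factorial_succ, Nat.cast_mul, Nat.cast_add,
    Nat.cast_one]
  rw [div_mul_eq_mul_div, div_mul_eq_mul_div, div_eq_div_iff
    (by positivity) (by positivity)]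
  ring

theorem ascPochhammer_succ_eval_left (n : ℕ) (a : ℝ) :
    (ascPochhammer ℝ (n + 1)).eval a = a * (ascPochhammer ℝ n).eval (a + 1) := by
  simp [ascPochhammer_succ_left]

/-- The difference operator lowers the index by one in the basis `(-x)_i`. This turns the difference
equation into a recurrence between consecutive coefficients. -/
theorem ascPochhammer_second_difference (i : ℕ) (x : ℝ) :
    (x + 2) * (ascPochhammer ℝ (i + 1)).eval (-(x + 1))
      - 2 * (x + 1) * (ascPochhammer ℝ (i + 1)).eval (-x)
      + x * (ascPochhammer ℝ (i + 1)).eval (-(x - 1))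
      = -((i + 1) * (i + 2)) * (ascPochhammer ℝ i).eval (-x) := by
  have h1 : (ascPochhammer ℝ (i + 1)).eval (-(x + 1))
      = -(x + 1) * (ascPochhammer ℝ i).eval (-x) := by
    rw [ascPochhammer_succ_eval_left]
    ring_nf
  have h2 : x * (ascPochhammer ℝ (i + 1)).eval (-(x - 1))
      = -(ascPochhammer ℝ (i + 1 + 1)).eval (-x) := by
    rw [ascPochhammer_succ_eval_left (i + 1) (-x)]
    ring_nf
  rw [h1, h2, ascPochhammer_succ_eval (i + 1), ascPochhammer_succ_eval]
  push_cast
  ring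

/-- The difference equation of the Hahn polynomials. -/
theorem hahn_difference_equation {N k : ℕ} (hk : k + 1 ≤ N) (x : ℝ) :
    (x - ((N : ℝ) - 1)) * ((x + 2) * hahn N k (x + 1) - 2 * (x + 1) * hahn N k x
      + x * hahn N k (x - 1)) = k * (k + 1) * hahn N k x := by
  have h1 : (x + 2) * hahn N k (x + 1) - 2 * (x + 1) * hahn N k x + x * hahn N k (x - 1)
      = ∑ i ∈ Finset.range k, hahnCoeff N k (i + 1) *
          (-((i + 1) * (i + 2)) * (ascPochhammer ℝ i).eval (-x)) := by
    simp only [hahn_eq_sum, Finset.mul_sum]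
    rw [← Finset.sum_sub_distrib, ← Finset.sum_add_distrib, Finset.sum_range_succ']
    rw [show (x + 2) * (hahnCoeff N k 0 * (ascPochhammer ℝ 0).eval (-(x + 1)))
      - 2 * (x + 1) * (hahnCoeff N k 0 * (ascPochhammer ℝ 0).eval (-x))
      + x * (hahnCoeff N k 0 * (ascPochhammer ℝ 0).eval (-(x - 1))) = 0 by simp; ring, add_zero]
    refine Finset.sum_congr rfl fun i _ => ?_
    rw [← ascPochhammer_second_difference]
    ring
  -- Splitting `x - (N - 1) = (i - (N - 1)) - (i - x)` produces indices `i` and `i + 1`. After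
  -- reindexing, the extra terms at `i = 0` and `i = k` vanish, and `i (i + 1) - (i - k)(i + k + 1)
  -- = k (k + 1)` remains.
  have h2 : ∀ i ∈ Finset.range k, (x - ((N : ℝ) - 1)) * (hahnCoeff N k (i + 1) *
      (-((i + 1) * (i + 2)) * (ascPochhammer ℝ i).eval (-x)))
      = hahnCoeff N k (i + 1) * (((i + 1 : ℕ) : ℝ) * (((i + 1 : ℕ) : ℝ) + 1))
          * (ascPochhammer ℝ (i + 1)).eval (-x)
        - hahnCoeff N k i * ((i - k) * (i + k + 1)) * (ascPochhammer ℝ i).eval (-x) := by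
    intro i hi
    have := Finset.mem_range.1 hi
    rw [← hahnCoeff_succ (by omega), ascPochhammer_succ_eval]
    push_cast
    ring
  have h3 : ∑ i ∈ Finset.range k, hahnCoeff N k (i + 1) * (((i + 1 : ℕ) : ℝ) *
      (((i + 1 : ℕ) : ℝ) + 1)) * (ascPochhammer ℝ (i + 1)).eval (-x)
      = ∑ i ∈ Finset.range (k + 1), hahnCoeff N k i * ((i : ℝ) * (i + 1))
          * (ascPochhammer ℝ i).eval (-x) := by
    rw [Finset.sum_range_succ']
    simp
  have h4 : ∑ i ∈ Finset.range k, hahnCoeff N k i * (((i : ℝ) - k) * (i + k + 1))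
        * (ascPochhammer ℝ i).eval (-x)
      = ∑ i ∈ Finset.range (k + 1), hahnCoeff N k i * (((i : ℝ) - k) * (i + k + 1))
          * (ascPochhammer ℝ i).eval (-x) := by
    rw [Finset.sum_range_succ]
    simp
  rw [h1, Finset.mul_sum, Finset.sum_congr rfl h2, Finset.sum_sub_distrib, h3, h4,
    ← Finset.sum_sub_distrib, hahn_eq_sum, Finset.mul_sum]
  exact Finset.sum_congr rfl fun i _ => by ring

/-- The left side of the difference equation vanishes at `x = N - 1`, while `k (k + 1) ≠ 0`. This
zero compensates the denominator `N - j` of `v`. -/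
theorem hahn_last_eq_zero {N k : ℕ} (hk : k + 1 ≤ N) (hk0 : 1 ≤ k) :
    hahn N k ((N : ℝ) - 1) = 0 := by
  have := hahn_difference_equation hk ((N : ℝ) - 1)
  rw [sub_self, zero_mul] at this
  have h1 : (0 : ℝ) < k * (k + 1) := by positivity
  exact (mul_eq_zero.1 this.symm).resolve_left h1.ne'

theorem hahn_zero (N k : ℕ) : hahn N k 0 = 1 := by
  rw [hahn_eq_sum, Finset.sum_range_succ']
  simp [ascPochhammer_succ_eval_left, hahnCoeff]

/-- Clears the denominator of `v`, and stays true at `j = N`, so the boundary rows of the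
eigenvector equation need no separate treatment. -/
theorem γ_mul_v {N k j : ℕ} (hk : k + 1 ≤ N) (hk0 : 1 ≤ k) (hj : j ≤ N) :
    γ N j * v N k j = ((N : ℝ) - 1) * j * hahn N k ((j : ℝ) - 1) := by
  rcases eq_or_lt_of_le hj with rfl | hj
  · rw [hahn_last_eq_zero hk hk0, γ]
    simp
  · have : (N : ℝ) - j ≠ 0 := by
      have : (j : ℝ) < N := by exact_mod_cast hj
      linarith
    rw [γ, v]
    field_simp

/-- The eigenvector equation, row by row. -/
theorem second_difference_γ_mul_v {N k j : ℕ} (hk : k + 1 ≤ N) (hk0 : 1 ≤ k) (hj : j + 2 ≤ N) :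
    2 * (γ N (j + 1) * v N k (j + 1)) - γ N j * v N k j - γ N (j + 2) * v N k (j + 2)
      = k * (k + 1) * v N k (j + 1) := by
  rw [γ_mul_v hk hk0 (by omega), γ_mul_v hk hk0 (by omega), γ_mul_v hk hk0 (by omega), v]
  have h1 := hahn_difference_equation hk (j : ℝ)
  have h2 : (N : ℝ) - (j + 1) ≠ 0 := by
    have : (j : ℝ) + 2 ≤ N := by exact_mod_cast hj
    linarith
  push_cast
  rw [show (j : ℝ) + 1 - 1 = j by ring, show (j : ℝ) + 2 - 1 = j + 1 by ring]
  field_simp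
  linear_combination ((N : ℝ) - 1) * h1

/-- The neighbours missing in the first and last rows may be written in, since `γ_0 = γ_N = 0`. -/
theorem sum_A_mul {N : ℕ} (i : Fin (N - 1)) (w : ℕ → ℝ) :
    ∑ j : Fin (N - 1), A N i j * w (j + 1)
      = 2 * (γ N (i + 1) * w (i + 1)) - γ N i * w i - γ N (i + 2) * w (i + 2) := by
  have hi := i.2
  have h0 : γ N 0 = 0 := by simp [γ]
  have hN : γ N N = 0 := by simp [γ]
  have e1 : ∀ j : Fin (N - 1), A N i j * w (j + 1)
      = (if (i : ℕ) = j then 2 * (γ N (j + 1) * w (j + 1)) else 0)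
        - (if (i : ℕ) = j + 1 then γ N (j + 1) * w (j + 1) else 0)
        - (if (i : ℕ) + 1 = j then γ N (j + 1) * w (j + 1) else 0) := by
    intro j
    simp only [A, Fin.ext_iff]
    split_ifs <;> ring
  simp only [e1, Finset.sum_sub_distrib]
  rw [Fin.sum_univ_eq_sum_range (fun j => if (i : ℕ) = j then 2 * (γ N (j + 1) * w (j + 1)) else 0),
    Fin.sum_univ_eq_sum_range (fun j => if (i : ℕ) = j + 1 then γ N (j + 1) * w (j + 1) else 0),
    Fin.sum_univ_eq_sum_range (fun j => if (i : ℕ) + 1 = j then γ N (j + 1) * w (j + 1) else 0),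
    Finset.sum_ite_eq, Finset.sum_ite_eq, if_pos (Finset.mem_range.2 hi)]
  congr 1
  · congr 1
    rcases Nat.eq_zero_or_eq_succ_pred (i : ℕ) with h | h
    · rw [h, h0, zero_mul]
      exact Finset.sum_eq_zero fun j _ => by rw [if_neg (by omega)]
    · rw [Finset.sum_eq_single ((i : ℕ) - 1), if_pos (by omega)]
      · rw [show (i : ℕ) - 1 + 1 = i by omega]
      · intro j _ hj
        rw [if_neg (by omega)]
      · intro hj
        exact absurd (Finset.mem_range.2 (by omega)) hj
  · split_ifs with h
    · rfl
    · have : (i : ℕ) + 2 = N := by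
        rw [Finset.mem_range] at h
        omega
      rw [this, hN, zero_mul]

theorem hasEigenvector_v {N : ℕ} (hN : 2 ≤ N) (k : Fin (N - 1)) :
    Module.End.HasEigenvector (Matrix.toLin' (A N)) (((k : ℝ) + 1) * ((k : ℝ) + 2))
      (fun j : Fin (N - 1) => v N (k + 1) (j + 1)) := by
  have hk := k.2
  refine ⟨Module.End.mem_eigenspace_iff.2 ?_, fun h => ?_⟩
  · ext i
    have hi := i.2
    rw [Matrix.toLin'_apply, Matrix.mulVec, dotProduct, sum_A_mul i (v N (k + 1)),
      second_difference_γ_mul_v (by omega) (by omega) (by omega)]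
    simp only [Pi.smul_apply, smul_eq_mul]
    push_cast
    ring
  · have h1 := congrFun h ⟨0, by omega⟩
    have h2 : (N : ℝ) - 1 ≠ 0 := by
      have : (2 : ℝ) ≤ N := by exact_mod_cast hN
      linarith
    simp [v, hahn_zero, h2] at h1

/-! ### The vectors `v_k` as polynomials, and their products -/

theorem degree_ascPochhammer_comp (i : ℕ) :
    ((ascPochhammer ℝ i).comp (1 - X)).degree = i := by
  have h1 : (1 - X : ℝ[X]).natDegree = 1 := by
    rw [show (1 - X : ℝ[X]) = -(X - C 1) by simp]
    rw [natDegree_neg, natDegree_X_sub_C]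
  have h2 : ((ascPochhammer ℝ i).comp (1 - X)).natDegree = i := by
    rw [natDegree_comp, h1, ascPochhammer_natDegree, mul_one]
  rcases Nat.eq_zero_or_pos i with rfl | hi
  · simp
  · rw [degree_eq_iff_natDegree_eq_of_pos hi, h2]

theorem hahnCoeff_last_ne_zero {N k : ℕ} (hk : k + 1 ≤ N) : hahnCoeff N k k ≠ 0 := by
  refine div_ne_zero (mul_ne_zero ?_ ?_) (mul_ne_zero (mul_ne_zero ?_ ?_) (by positivity))
  · refine ascPochhammer_eval_ne_zero fun i hi h => ?_
    have : (i : ℝ) < k := by exact_mod_cast hi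
    linarith
  · exact ascPochhammer_eval_ne_zero fun i _ => by positivity
  · exact ascPochhammer_two_ne_zero k
  · exact ascPochhammer_neg_sub_ne_zero hk

/-- The Hahn polynomial `Q_{k+1}(x - 1)` has degree `k + 1` and a root at `x = N`. Dividing by `N -
x` therefore leaves a polynomial, of degree exactly `k`. -/
theorem exists_polynomial_v {N k : ℕ} (hk : k + 2 ≤ N) :
    ∃ p : ℝ[X], p.degree = k ∧ ∀ j < N, v N (k + 1) j = p.eval (j : ℝ) := by
  let q : ℝ[X] := ∑ i ∈ Finset.range (k + 1 + 1),
    C (hahnCoeff N (k + 1) i) * (ascPochhammer ℝ i).comp (1 - X)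
  have hq : ∀ x, q.eval x = hahn N (k + 1) (x - 1) := fun x => by
    simp [q, hahn_eq_sum, eval_finsetSum]
  have hqd : q.degree = (k + 1 : ℕ) := by
    simp only [q]
    rw [Finset.sum_range_succ]
    have h1 : (C (hahnCoeff N (k + 1) (k + 1)) * (ascPochhammer ℝ (k + 1)).comp (1 - X)).degree
        = (k + 1 : ℕ) := by
      rw [degree_C_mul (hahnCoeff_last_ne_zero (by omega)), degree_ascPochhammer_comp]
    rw [degree_add_eq_right_of_degree_lt, h1]
    rw [h1]
    refine (degree_sum_le _ _).trans_lt ?_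
    rw [Finset.sup_lt_iff (WithBot.bot_lt_coe _)]
    intro i hi
    rw [C_mul']
    refine (degree_smul_le _ _).trans_lt ?_
    rw [degree_ascPochhammer_comp]
    exact_mod_cast Finset.mem_range.1 hi
  obtain ⟨p, hp⟩ := dvd_iff_isRoot.2
    (show q.IsRoot (N : ℝ) by rw [IsRoot, hq, hahn_last_eq_zero (by omega) (by omega)])
  have hN : (2 : ℝ) ≤ N := by exact_mod_cast (by omega : 2 ≤ N)
  refine ⟨C (-((N : ℝ) - 1)) * p, ?_, fun j hj => ?_⟩
  · rw [degree_C_mul (by linarith)]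
    have hp0 : p ≠ 0 := by
      rintro rfl
      rw [mul_zero] at hp
      rw [hp, degree_zero] at hqd
      exact absurd hqd.symm (WithBot.natCast_ne_bot _)
    rw [hp, degree_mul, degree_X_sub_C, degree_eq_natDegree hp0] at hqd
    rw [degree_eq_natDegree hp0]
    have : 1 + p.natDegree = k + 1 := by exact_mod_cast hqd
    exact_mod_cast (by omega : p.natDegree = k)
  · have hj' : (N : ℝ) - j ≠ 0 := by
      have : (j : ℝ) < N := by exact_mod_cast hj
      linarith
    have h2 := hq j
    rw [hp, eval_mul] at h2
    simp only [eval_sub, eval_X, eval_C] at h2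
    rw [v, ← h2, eval_mul, eval_C]
    field_simp
    ring

/-- Triangular elimination: subtracting a multiple of `p_m` removes the coefficient of degree `m`.
Recording which coefficients vanish is what controls the powers of `r` later. -/
theorem exists_sum_of_degree_lt {n : ℕ} {p : Fin n → ℝ[X]} (hp : ∀ a, (p a).degree = (a : ℕ))
    (m : ℕ) (hm : m ≤ n) (q : ℝ[X]) (hq : q.degree < m) :
    ∃ c : Fin n → ℝ, (∀ a : Fin n, m ≤ a → c a = 0) ∧ q = ∑ a, C (c a) * p a := by
  induction m generalizing q with
  | zero =>
    refine ⟨0, fun _ _ => rfl, ?_⟩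
    have : q = 0 := by
      rw [← degree_eq_bot, ← Nat.WithBot.lt_zero_iff]
      exact_mod_cast hq
    simp [this]
  | succ m ih =>
    let a₀ : Fin n := ⟨m, by omega⟩
    have hlead : (p a₀).coeff m ≠ 0 := by
      have h1 : (p a₀).natDegree = m := natDegree_eq_of_degree_eq_some (hp a₀)
      rw [← h1]
      refine leadingCoeff_ne_zero.2 fun h0 => ?_
      have := hp a₀
      rw [h0, degree_zero] at this
      exact absurd this.symm (WithBot.natCast_ne_bot _)
    let b := q.coeff m / (p a₀).coeff m
    obtain ⟨c, hc, hqc⟩ := ih (by omega) (q - C b * p a₀) (by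
      rw [degree_lt_iff_coeff_zero]
      intro i hi
      rcases hi.eq_or_lt with rfl | hi
      · rw [coeff_sub, coeff_C_mul, div_mul_cancel₀ _ hlead, sub_self]
      · rw [coeff_sub, coeff_C_mul, coeff_eq_zero_of_degree_lt (hq.trans_le ?_),
          coeff_eq_zero_of_degree_lt (n := i) (p := p a₀) ?_, mul_zero, sub_zero]
        · rw [hp]
          exact_mod_cast hi
        · exact_mod_cast hi)
    refine ⟨fun a => c a + if a = a₀ then b else 0, fun a ha => ?_, ?_⟩
    · have : a ≠ a₀ := by
        rintro rfl
        simp only [a₀] at ha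
        omega
      simp only
      rw [if_neg this, hc a (by omega), add_zero]
    · rw [← sub_add_cancel q (C b * p a₀), hqc]
      simp only [C_add, add_mul, Finset.sum_add_distrib]
      congr 1
      rw [Finset.sum_eq_single a₀]
      · simp
      · intro a _ ha
        simp [ha]
      · simp

/-- The products of the vectors `v_k` expand in these vectors, respecting the degrees. -/
theorem exists_structure_constants (N : ℕ) :
    ∃ T : Fin (N - 1) → Fin (N - 1) → Fin (N - 1) → ℝ,
      (∀ a b c : Fin (N - 1), (a : ℕ) + b < c → T a b c = 0) ∧
      ∀ a b : Fin (N - 1), ∀ j ∈ Finset.Icc 1 (N - 1),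
        v N (a + 1) j * v N (b + 1) j = ∑ c, T a b c * v N (c + 1) j := by
  have hex : ∀ a : Fin (N - 1), ∃ p : ℝ[X], p.degree = (a : ℕ) ∧
      ∀ j < N, v N (a + 1) j = p.eval (j : ℝ) := fun a => exists_polynomial_v (by omega)
  choose p hp hpv using hex
  have hab : ∀ a b : Fin (N - 1), ∃ c : Fin (N - 1) → ℝ,
      (∀ i : Fin (N - 1), (a : ℕ) + b < i → c i = 0) ∧ ∀ j ∈ Finset.Icc 1 (N - 1),
        v N (a + 1) j * v N (b + 1) j = ∑ i, c i * v N (i + 1) j := by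
    intro a b
    obtain ⟨m, q, hm, hma, hqd, hq⟩ : ∃ (m : ℕ) (q : ℝ[X]), m ≤ N - 1 ∧ m ≤ a + b + 1 ∧
        q.degree < m ∧ ∀ j ∈ Finset.Icc 1 (N - 1),
          v N (a + 1) j * v N (b + 1) j = q.eval (j : ℝ) := by
      -- For small `a + b` the polynomial product itself has degree `a + b`. Otherwise no index `c`
      -- exceeds `a + b`, so any polynomial with the right values at the `N - 1` nodes will do.
      rcases lt_or_ge ((a : ℕ) + b) (N - 1) with h | h
      · refine ⟨a + b + 1, p a * p b, h, le_rfl, ?_, fun j hj => ?_⟩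
        · rw [degree_mul, hp, hp]
          exact_mod_cast Nat.lt_succ_self _
        · have := Finset.mem_Icc.1 hj
          rw [hpv a j (by omega), hpv b j (by omega), eval_mul]
      · refine ⟨N - 1, Lagrange.interpolate (Finset.Icc 1 (N - 1)) (fun j : ℕ => (j : ℝ))
          fun j => v N (a + 1) j * v N (b + 1) j, le_rfl, by omega, ?_, fun j hj => ?_⟩
        · have := Lagrange.degree_interpolate_lt (s := Finset.Icc 1 (N - 1))
            (v := fun j : ℕ => (j : ℝ)) (fun j => v N (a + 1) j * v N (b + 1) j)
            (fun x _ y _ hxy => Nat.cast_injective hxy)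
          simpa using this
        · exact (Lagrange.eval_interpolate_at_node (v := fun j : ℕ => (j : ℝ))
            (fun j => v N (a + 1) j * v N (b + 1) j)
            (fun x _ y _ hxy => Nat.cast_injective hxy) hj).symm
    obtain ⟨c, hc, hqc⟩ := exists_sum_of_degree_lt hp m hm q hqd
    refine ⟨c, fun i hi => hc i (by omega), fun j hj => ?_⟩
    have := Finset.mem_Icc.1 hj
    rw [hq j hj, hqc, eval_finsetSum]
    exact Finset.sum_congr rfl fun i _ => by rw [eval_mul, eval_C, hpv i j (by omega)]
  choose T hT using hab
  exact ⟨T, fun a b c h => (hT a b).1 c h, fun a b => (hT a b).2⟩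

end

section

open Filter Topology

/-! ### Expansions in the vectors `v_k` -/

/-- The expansion `j ↦ ∑ x_a v_{a+1}^j r^a`. -/
def expand (N : ℕ) (r : ℝ) : (Fin (N - 1) → ℝ) →ₗ[ℝ] (ℕ → ℝ) where
  toFun x j := ∑ a, x a * v N (a + 1) j * r ^ (a : ℕ)
  map_add' x y := by
    ext j
    simp only [Pi.add_apply, add_mul, Finset.sum_add_distrib]
  map_smul' c x := by
    ext j
    simp only [Pi.smul_apply, smul_eq_mul, RingHom.id_apply, Finset.mul_sum, mul_assoc]

theorem expand_apply (N : ℕ) (r : ℝ) (x : Fin (N - 1) → ℝ) (j : ℕ) :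
    expand N r x j = ∑ a, x a * v N (a + 1) j * r ^ (a : ℕ) := rfl

/-- The eigenvalues of `A`, acting diagonally on the coefficients. -/
def eigenMul {n : ℕ} (x : Fin n → ℝ) (a : Fin n) : ℝ := ((a : ℝ) + 1) * (a + 2) * x a

/-- The structure constants of the products of the vectors `v_k`. -/
def structureConstant (N : ℕ) : Fin (N - 1) → Fin (N - 1) → Fin (N - 1) → ℝ :=
  (exists_structure_constants N).choose

/-- The product of coefficient vectors that corresponds to the product of the expansions. -/
def star (N : ℕ) (r : ℝ) (x y : Fin (N - 1) → ℝ) (c : Fin (N - 1)) : ℝ :=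
  ∑ a, ∑ b, structureConstant N a b c * x a * y b * r ^ ((a : ℕ) + b - c)

theorem expand_star {N j : ℕ} (hj : j ∈ Finset.Icc 1 (N - 1)) (r : ℝ) (x y : Fin (N - 1) → ℝ) :
    expand N r (star N r x y) j = expand N r x j * expand N r y j := by
  obtain ⟨h0, h1⟩ := (exists_structure_constants N).choose_spec
  simp only [expand_apply]
  rw [Finset.sum_mul_sum]
  simp only [star, Finset.sum_mul]
  rw [Finset.sum_comm]
  refine Finset.sum_congr rfl fun a _ => ?_
  rw [Finset.sum_comm]
  refine Finset.sum_congr rfl fun b _ => ?_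
  rw [show x a * v N (a + 1) j * r ^ (a : ℕ) * (y b * v N (b + 1) j * r ^ (b : ℕ))
    = (v N (a + 1) j * v N (b + 1) j) * (x a * y b * r ^ ((a : ℕ) + b)) by ring, h1 a b j hj,
    Finset.sum_mul]
  refine Finset.sum_congr rfl fun c _ => ?_
  -- The exponent in `star` is a truncated subtraction; where it truncates, the structure constant
  -- is zero.
  rcases lt_or_ge ((a : ℕ) + b) c with h | h
  · rw [structureConstant, h0 a b c h]
    ring
  · obtain ⟨d, hd⟩ := Nat.exists_eq_add_of_le h
    rw [hd, Nat.add_sub_cancel_left, structureConstant, pow_add]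
    ring

theorem γ_self (N : ℕ) : γ N N = 0 := by simp [γ]

theorem γ_zero (N : ℕ) : γ N 0 = 0 := by simp [γ]

/-- The product rule is known only for `1 ≤ j ≤ N - 1`; the factor `γ` extends it to the two
boundary indices that second differences reach. -/
theorem γ_mul_expand_star {N j : ℕ} (hj : j ≤ N) (r : ℝ) (x y : Fin (N - 1) → ℝ) :
    γ N j * expand N r (star N r x y) j = γ N j * (expand N r x j * expand N r y j) := by
  rcases Nat.eq_zero_or_pos j with rfl | h0
  · simp [γ_zero]
  · rcases hj.eq_or_lt with rfl | h1
    · simp [γ_self]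
    · rw [expand_star (Finset.mem_Icc.2 ⟨h0, by omega⟩)]

/-- The operator `w ↦ 2 γ_j w_j - γ_{j-1} w_{j-1} - γ_{j+1} w_{j+1}`. -/
def secondDiff (N : ℕ) (w : ℕ → ℝ) (j : ℕ) : ℝ :=
  2 * (γ N j * w j) - γ N (j - 1) * w (j - 1) - γ N (j + 1) * w (j + 1)

theorem secondDiff_expand {N j : ℕ} (hj : j ∈ Finset.Icc 1 (N - 1)) (r : ℝ)
    (x : Fin (N - 1) → ℝ) :
    secondDiff N (expand N r x) j = expand N r (eigenMul x) j := by
  obtain ⟨h1, h2⟩ := Finset.mem_Icc.1 hj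
  obtain ⟨i, rfl⟩ : ∃ i, j = i + 1 := ⟨j - 1, by omega⟩
  simp only [secondDiff, expand_apply, eigenMul, Finset.mul_sum, Nat.add_sub_cancel]
  rw [← Finset.sum_sub_distrib, ← Finset.sum_sub_distrib]
  refine Finset.sum_congr rfl fun a _ => ?_
  have ha := a.2
  have := second_difference_γ_mul_v (N := N) (k := a + 1) (j := i) (by omega) (by omega) (by omega)
  push_cast at this
  linear_combination x a * r ^ (a : ℕ) * this

/-- Mode `a` carries `r^{a+m}`, so `r d/dr` acts on its coefficient as `a + m + r d/dr`. The cases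
used are `m = 2, 1` for `u` and `u'`, and `m = 1, 0` for `ℰ` and `ℰ'`. -/
theorem hasDerivAt_pow_mul_expand {N : ℕ} {r : ℝ} (hr : r ≠ 0) {X : ℝ → Fin (N - 1) → ℝ}
    {X' : Fin (N - 1) → ℝ} (hX : ∀ a, HasDerivAt (fun x => X x a) (X' a) r) (m j : ℕ) :
    HasDerivAt (fun x => x ^ m * expand N x (X x) j)
      (r ^ m * expand N r (fun a => (a + m) * X r a + r * X' a) j / r) r := by
  have h1 : ∀ x, x ^ m * expand N x (X x) j
      = ∑ a, X x a * (v N (a + 1) j * x ^ ((a : ℕ) + m)) := fun x => by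
    rw [expand_apply, Finset.mul_sum]
    exact Finset.sum_congr rfl fun a _ => by ring
  simp only [h1]
  refine (HasDerivAt.fun_sum fun a _ =>
    (hX a).mul ((hasDerivAt_pow ((a : ℕ) + m) r).const_mul (v N (a + 1) j))).congr_deriv ?_
  rw [expand_apply, Finset.mul_sum, Finset.sum_div]
  refine Finset.sum_congr rfl fun a _ => ?_
  have h2 : (((a : ℕ) + m : ℕ) : ℝ) * r ^ ((a : ℕ) + m - 1)
      = ((a : ℝ) + m) * r ^ ((a : ℕ) + m) / r := by
    rcases Nat.eq_zero_or_pos ((a : ℕ) + m) with h | h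
    · have h3 : ((a : ℝ) + m) = 0 := by exact_mod_cast h
      rw [h, h3]
      simp
    · obtain ⟨d, hd⟩ := Nat.exists_eq_add_of_le' h
      rw [hd, Nat.add_sub_cancel, pow_succ, ← mul_assoc, mul_div_cancel_right₀ _ hr, ← hd]
      push_cast
      ring
  rw [h2]
  field_simp
  ring

/-! ### The singular system -/

/-- The components of the singular system: the coefficients of the magnetic and electric functions,
their derivatives, the metric function `S` and the quotient `m / r`. -/
inductive Component (n : ℕ)
  | mag (a : Fin n)
  | magDeriv (a : Fin n)
  | el (a : Fin n)
  | elDeriv (a : Fin n)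
  | metric
  | massRatio
  deriving Fintype

open Component

section System

variable (N : ℕ) (ℓ r : ℝ) (y : Component (N - 1) → ℝ) (M : ℝ)

def magCoeff (a : Fin (N - 1)) : ℝ := y (mag a)

def elCoeff (a : Fin (N - 1)) : ℝ := y (el a)

/-- The coefficients of `u'`, where `ω_j = √γ_j (1 + u_j)`. -/
def magCoeff₁ (a : Fin (N - 1)) : ℝ := (a + 2) * y (mag a) + r * y (magDeriv a)

/-- The coefficients of `ℰ'`. -/
def elCoeff₁ (a : Fin (N - 1)) : ℝ := (a + 1) * y (el a) + r * y (elDeriv a)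

def muFn : ℝ := 1 - 2 * y massRatio + r ^ 2 / ℓ ^ 2

/-- `(μ - 1) / r ^ 2` -/
def nuFn : ℝ := -2 * M + 1 / ℓ ^ 2

/-- The traceless solution of `α_j - α_{j+1} = w_j`. -/
def traceless (w : ℕ → ℝ) (j : ℕ) : ℝ :=
  ∑ i ∈ Finset.Icc 1 (N - 1), (if j ≤ i then w i else 0) - 1 / N *
    ∑ i ∈ Finset.Icc 1 (N - 1), i * w i

def etaFn : ℝ :=
  ∑ j ∈ Finset.Icc 1 N, traceless N (expand N r (elCoeff₁ N r y)) j ^ 2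

/-- `ζ / r ^ 2` -/
def zetaFn : ℝ :=
  ∑ j ∈ Finset.Icc 1 (N - 1), γ N j * (1 + r ^ 2 * expand N r (magCoeff N y) j) ^ 2
    * expand N r (elCoeff N y) j ^ 2

/-- `G / r ^ 2` -/
def gFn : ℝ := ∑ j ∈ Finset.Icc 1 (N - 1), γ N j * expand N r (magCoeff₁ N r y) j ^ 2

/-- `((1 + u_j) ^ 2 - 1) / r ^ 2` -/
def sqDefect (j : ℕ) : ℝ :=
  2 * expand N r (magCoeff N y) j + r ^ 2 * expand N r (magCoeff N y) j ^ 2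

/-- `P / r ^ 2` -/
def pFn : ℝ :=
  1 / 4 * ∑ j ∈ Finset.Icc 1 N,
    (γ N j * sqDefect N r y j - γ N (j - 1) * sqDefect N r y (j - 1)) ^ 2

/-- `m' / r ^ 2` -/
def massFn : ℝ :=
  etaFn N r y / (4 * y metric ^ 2) + zetaFn N r y / (4 * muFn N ℓ r y * y metric ^ 2)
    + muFn N ℓ r y * gFn N r y + pFn N r y

/-- `S' / (r S)` -/
def sigmaFn : ℝ :=
  zetaFn N r y / (2 * muFn N ℓ r y ^ 2 * y metric ^ 2) + 2 * gFn N r y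

/-- The right side of the magnetic equation divided by `√γ_j r⁴`, after removal of its leading term
`r² eigenMul`. That term combines with `μ r² eigenMul` on the left into `r⁴ ν eigenMul`, which is
subtracted in `magRhs`. -/
def magSource : Fin (N - 1) → ℝ :=
  (-2 * (M - pFn N r y + 1 / ℓ ^ 2 - etaFn N r y / (4 * y metric ^ 2))) • magCoeff₁ N r y
    - (1 / (4 * muFn N ℓ r y * y metric ^ 2)) • (star N r (elCoeff N y) (elCoeff N y)
      + r ^ 2 • star N r (magCoeff N y) (star N r (elCoeff N y) (elCoeff N y)))
    + (1 / 2 : ℝ) • eigenMul (star N r (magCoeff N y) (magCoeff N y))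
    + star N r (eigenMul (magCoeff N y)) (magCoeff N y)
    + (r ^ 2 / 2) • star N r (eigenMul (star N r (magCoeff N y) (magCoeff N y))) (magCoeff N y)

/-- The right hand side of the magnetic equations. -/
def magRhs : Fin (N - 1) → ℝ :=
  (1 / muFn N ℓ r y) • (magSource N ℓ r y M - nuFn ℓ M • eigenMul (magCoeff N y))

/-- The right hand side of the electric equations. -/
def elRhs : Fin (N - 1) → ℝ :=
  sigmaFn N ℓ r y • elCoeff₁ N r y + (1 / muFn N ℓ r y) • (-nuFn ℓ M • eigenMul (elCoeff N y)
    + (2 : ℝ) • eigenMul (star N r (magCoeff N y) (elCoeff N y))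
    + r ^ 2 • eigenMul (star N r (star N r (magCoeff N y) (magCoeff N y)) (elCoeff N y)))

end System

/-- The right hand side of the singular system. -/
def systemRhs (N : ℕ) (ℓ : ℝ) :
    Component (N - 1) → (ℝ × (Component (N - 1) → ℝ)) × ℝ → ℝ
  | mag a, z => z.1.2 (magDeriv a)
  | magDeriv a, z => magRhs N ℓ z.1.1 z.1.2 z.2 a
  | el a, z => z.1.2 (elDeriv a)
  | elDeriv a, z => elRhs N ℓ z.1.1 z.1.2 z.2 a
  | metric, z => z.1.1 * sigmaFn N ℓ z.1.1 z.1.2 * z.1.2 metric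
  | massRatio, z => z.1.1 * massFn N ℓ z.1.1 z.1.2

/-- For mode `k = a + 1` the coefficient of the first derivative is `2k + 2 = 2a + 4` in both
Yang-Mills equations. The exponent `1` comes from `r (m / r)' = -m / r + m'`. -/
def systemExponent (N : ℕ) : Component (N - 1) → ℕ
  | mag _ => 0
  | magDeriv a => 2 * a + 4
  | el _ => 0
  | elDeriv a => 2 * a + 4
  | metric => 0
  | massRatio => 1

/-- The fields determined by a solution of the singular system. -/
def toFields (N : ℕ) (y : ℝ → Component (N - 1) → ℝ) (M : ℝ → ℝ) : Fields where
  m r := r ^ 3 * M r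
  S r := y r metric
  α j r := if j ∈ Finset.Icc 1 N then
    traceless N (fun i => r * expand N r (elCoeff N (y r)) i) j else 0
  ω j r := √((j : ℝ) * ((N : ℝ) - j)) * (1 + r ^ 2 * expand N r (magCoeff N (y r)) j)

end

/-! ### From the singular system to the field equations. -/

section

open Filter Topology Component

theorem traceless_sub_traceless {N j : ℕ} (hj : j ∈ Finset.Icc 1 (N - 1)) (w : ℕ → ℝ) :
    traceless N w j - traceless N w (j + 1) = w j := by
  rw [traceless, traceless, sub_sub_sub_cancel_right, ← Finset.sum_sub_distrib,
    Finset.sum_eq_single_of_mem j hj]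
  · simp
  · intro i _ hi
    rcases lt_or_gt_of_ne hi with h | h
    · rw [if_neg (by omega), if_neg (by omega), sub_zero]
    · rw [if_pos (by omega), if_pos (by omega), sub_self]

theorem sum_traceless {N : ℕ} (hN : N ≠ 0) (w : ℕ → ℝ) :
    ∑ j ∈ Finset.Icc 1 N, traceless N w j = 0 := by
  have hN' : (N : ℝ) ≠ 0 := by exact_mod_cast hN
  simp only [traceless, Finset.sum_sub_distrib, Finset.sum_const, Nat.card_Icc,
    Nat.add_sub_cancel, nsmul_eq_mul]
  rw [Finset.sum_comm, ← mul_assoc, mul_one_div_cancel hN', one_mul, sub_eq_zero]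
  refine Finset.sum_congr rfl fun i hi => ?_
  have hi' := Finset.mem_Icc.1 hi
  rw [← Finset.sum_filter, Finset.sum_const, nsmul_eq_mul]
  congr 2
  rw [show (Finset.Icc 1 N).filter (fun j => j ≤ i) = Finset.Icc 1 i by
    ext j
    simp only [Finset.mem_filter, Finset.mem_Icc]
    omega]
  simp

theorem hasDerivAt_traceless {N j : ℕ} {r : ℝ} {w : ℕ → ℝ → ℝ} {w' : ℕ → ℝ}
    (hw : ∀ i ∈ Finset.Icc 1 (N - 1), HasDerivAt (w i) (w' i) r) :
    HasDerivAt (fun x => traceless N (fun i => w i x) j) (traceless N w' j) r := by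
  unfold traceless
  refine (HasDerivAt.fun_sum fun i hi => ?_).sub
    ((HasDerivAt.fun_sum fun i hi => (hw i hi).const_mul (i : ℝ)).const_mul _)
  split_ifs
  · exact hw i hi
  · exact hasDerivAt_const _ _

section

variable {N : ℕ} {ℓ r : ℝ} {y : ℝ → Component (N - 1) → ℝ} {M : ℝ → ℝ}

theorem toFields_ω (N : ℕ) (y : ℝ → Component (N - 1) → ℝ) (M : ℝ → ℝ) (j : ℕ) :
    (toFields N y M).ω j
      = fun x => √(γ N j) * (1 + x ^ 2 * expand N x (magCoeff N (y x)) j) := rfl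

theorem toFields_ω_sq {j : ℕ} (hj : j ≤ N) (x : ℝ) :
    (toFields N y M).ω j x ^ 2 = γ N j * (1 + x ^ 2 * expand N x (magCoeff N (y x)) j) ^ 2 := by
  have : 0 ≤ γ N j := mul_nonneg (by positivity) (sub_nonneg.2 (by exact_mod_cast hj))
  rw [toFields_ω, mul_pow, Real.sq_sqrt this]

theorem toFields_ω_sq' {j : ℕ} (hj : j ≤ N) (x : ℝ) :
    (toFields N y M).ω j x ^ 2 = γ N j + x ^ 2 * (γ N j * sqDefect N x (y x) j) := by
  rw [toFields_ω_sq hj, sqDefect]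
  ring

theorem toFields_E {j : ℕ} (hj : j ∈ Finset.Icc 1 (N - 1)) :
    (toFields N y M).E j = fun x => x * expand N x (elCoeff N (y x)) j := by
  have hj' := Finset.mem_Icc.1 hj
  ext x
  simp only [Fields.E, toFields]
  rw [if_pos (Finset.mem_Icc.2 (by omega)), if_pos (Finset.mem_Icc.2 (by omega)),
    traceless_sub_traceless hj]

theorem hasDerivAt_toFields_ω (hr : r ≠ 0)
    (h : ∀ a, HasDerivAt (fun x => y x (mag a)) (y r (magDeriv a)) r) (j : ℕ) :
    HasDerivAt ((toFields N y M).ω j)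
      (√(γ N j) * (r * expand N r (magCoeff₁ N r (y r)) j)) r := by
  have h1 := hasDerivAt_pow_mul_expand hr (X := fun x => magCoeff N (y x)) h 2 j
  refine ((h1.const_add 1).const_mul _).congr_deriv ?_
  rw [show (fun a : Fin (N - 1) => ((a : ℝ) + (2 : ℕ)) * magCoeff N (y r) a
    + r * y r (magDeriv a)) = magCoeff₁ N r (y r) from rfl]
  change √(γ N j) * _ = _
  field_simp

theorem hasDerivAt_expand_el (hr : r ≠ 0)
    (h : ∀ a, HasDerivAt (fun x => y x (el a)) (y r (elDeriv a)) r) (j : ℕ) :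
    HasDerivAt (fun x => x * expand N x (elCoeff N (y x)) j)
      (expand N r (elCoeff₁ N r (y r)) j) r := by
  have h1 := hasDerivAt_pow_mul_expand hr (X := fun x => elCoeff N (y x)) h 1 j
  simp only [pow_one, Nat.cast_one] at h1
  refine h1.congr_deriv ?_
  rw [show (fun a : Fin (N - 1) => ((a : ℝ) + 1) * elCoeff N (y r) a
    + r * y r (elDeriv a)) = elCoeff₁ N r (y r) from rfl]
  field_simp

theorem eventually_deriv_toFields_ω (hr : r ≠ 0)
    (h : ∀ᶠ x in 𝓝 r, ∀ a, HasDerivAt (fun x => y x (mag a)) (y x (magDeriv a)) x) (j : ℕ) :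
    deriv ((toFields N y M).ω j) =ᶠ[𝓝 r]
      fun x => √(γ N j) * (x * expand N x (magCoeff₁ N x (y x)) j) := by
  filter_upwards [h, isOpen_ne.mem_nhds hr] with x hx hx0
  exact (hasDerivAt_toFields_ω hx0 hx j).deriv

theorem eventually_deriv_toFields_E (hr : r ≠ 0)
    (h : ∀ᶠ x in 𝓝 r, ∀ a, HasDerivAt (fun x => y x (el a)) (y x (elDeriv a)) x) {j : ℕ}
    (hj : j ∈ Finset.Icc 1 (N - 1)) :
    deriv ((toFields N y M).E j) =ᶠ[𝓝 r] fun x => expand N x (elCoeff₁ N x (y x)) j := by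
  filter_upwards [h, isOpen_ne.mem_nhds hr] with x hx hx0
  rw [toFields_E hj]
  exact (hasDerivAt_expand_el hx0 hx j).deriv

/-- The exponent `2a + 4` is exactly what cancels all terms in `magDeriv`, leaving the eigenvalue
term and the source. -/
theorem deriv_deriv_toFields_ω (hr : r ≠ 0)
    (h : ∀ᶠ x in 𝓝 r, ∀ a, HasDerivAt (fun x => y x (mag a)) (y x (magDeriv a)) x)
    (h' : ∀ a, HasDerivAt (fun x => y x (magDeriv a))
      (magRhs N ℓ r (y r) (M r) a - (2 * a + 4) * y r (magDeriv a) / r) r) (j : ℕ) :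
    deriv (deriv ((toFields N y M).ω j)) r = √(γ N j) *
      expand N r (eigenMul (magCoeff N (y r)) + r ^ 2 • magRhs N ℓ r (y r) (M r)) j := by
  rw [(eventually_deriv_toFields_ω hr h j).deriv_eq]
  have h1 : ∀ a, HasDerivAt (fun x => magCoeff₁ N x (y x) a)
      (r * magRhs N ℓ r (y r) (M r) a - (a + 1) * y r (magDeriv a)) r := fun a => by
    refine (((h.self_of_nhds a).const_mul ((a : ℝ) + 2)).add
      ((hasDerivAt_id r).mul (h' a))).congr_deriv ?_
    simp only [id_eq]
    field_simp
    ring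
  have h2 := hasDerivAt_pow_mul_expand hr h1 1 j
  simp only [pow_one, Nat.cast_one] at h2
  rw [(h2.const_mul (√(γ N j))).deriv, mul_div_cancel_left₀ _ hr]
  refine congrArg (fun x => √(γ N j) * expand N r x j) ?_
  ext a
  simp only [magCoeff₁, magCoeff, eigenMul, Pi.add_apply, Pi.smul_apply, smul_eq_mul]
  ring

theorem deriv_deriv_toFields_E (hr : r ≠ 0)
    (h : ∀ᶠ x in 𝓝 r, ∀ a, HasDerivAt (fun x => y x (el a)) (y x (elDeriv a)) x)
    (h' : ∀ a, HasDerivAt (fun x => y x (elDeriv a))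
      (elRhs N ℓ r (y r) (M r) a - (2 * a + 4) * y r (elDeriv a) / r) r) {j : ℕ}
    (hj : j ∈ Finset.Icc 1 (N - 1)) :
    r * deriv (deriv ((toFields N y M).E j)) r + 2 * deriv ((toFields N y M).E j) r =
      expand N r (eigenMul (elCoeff N (y r)) + r ^ 2 • elRhs N ℓ r (y r) (M r)) j := by
  have h0 := eventually_deriv_toFields_E (M := M) hr h hj
  rw [h0.deriv_eq, h0.self_of_nhds]
  have h1 : ∀ a, HasDerivAt (fun x => elCoeff₁ N x (y x) a)
      (r * elRhs N ℓ r (y r) (M r) a - (a + 2) * y r (elDeriv a)) r := fun a => by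
    refine (((h.self_of_nhds a).const_mul ((a : ℝ) + 1)).add
      ((hasDerivAt_id r).mul (h' a))).congr_deriv ?_
    simp only [id_eq]
    field_simp
    ring
  have h2 := hasDerivAt_pow_mul_expand hr h1 0 j
  simp only [pow_zero, one_mul, Nat.cast_zero, add_zero] at h2
  rw [h2.deriv, mul_div_cancel₀ _ hr, ← smul_eq_mul 2, ← Pi.smul_apply, ← map_smul,
    ← Pi.add_apply, ← map_add]
  refine congrArg (fun x => expand N r x j) ?_
  ext a
  simp only [elCoeff₁, elCoeff, eigenMul, Pi.add_apply, Pi.smul_apply, smul_eq_mul]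
  ring

/-- This includes `r = 0`, where the convention `m / 0 = 0` agrees with the limit of `m / r`. -/
theorem toFields_μ (hn : y r massRatio = r ^ 2 * M r) :
    (toFields N y M).μ 1 ℓ r = muFn N ℓ r (y r) := by
  simp only [Fields.μ, toFields, muFn, hn]
  field_simp

theorem toFields_η (hr : r ≠ 0)
    (h : ∀ a, HasDerivAt (fun x => y x (el a)) (y r (elDeriv a)) r) :
    (toFields N y M).η N r = etaFn N r (y r) := by
  refine Finset.sum_congr rfl fun j hj => ?_
  have h1 : (toFields N y M).α j
      = fun x => traceless N (fun i => x * expand N x (elCoeff N (y x)) i) j := by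
    ext x
    simp only [toFields]
    rw [if_pos hj]
  rw [h1, (hasDerivAt_traceless (w := fun i x => x * expand N x (elCoeff N (y x)) i)
    fun i _ => hasDerivAt_expand_el hr h i).deriv]

theorem toFields_ζ : (toFields N y M).ζ N r = r ^ 2 * zetaFn N r (y r) := by
  rw [Fields.ζ, zetaFn, Finset.mul_sum]
  refine Finset.sum_congr rfl fun j hj => ?_
  rw [toFields_ω_sq (by have := Finset.mem_Icc.1 hj; omega), toFields_E hj]
  ring

theorem toFields_G (hr : r ≠ 0)
    (h : ∀ a, HasDerivAt (fun x => y x (mag a)) (y r (magDeriv a)) r) :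
    (toFields N y M).G N r = r ^ 2 * gFn N r (y r) := by
  rw [Fields.G, gFn, Finset.mul_sum]
  refine Finset.sum_congr rfl fun j hj => ?_
  have hj' := Finset.mem_Icc.1 hj
  have : 0 ≤ γ N j :=
    mul_nonneg (by positivity) (sub_nonneg.2 (by exact_mod_cast (by omega : j ≤ N)))
  rw [(hasDerivAt_toFields_ω hr h j).deriv, mul_pow, Real.sq_sqrt this]
  ring

/-- The constants cancel because `γ_j - γ_{j-1} = N + 1 - 2j`. Each bracket is then of order `r²`,
which beats the prefactor `1 / r²`. -/
theorem toFields_P (hr : r ≠ 0) : (toFields N y M).P 1 N r = r ^ 2 * pFn N r (y r) := by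
  rw [Fields.P, pFn, Finset.mul_sum, Finset.mul_sum, Finset.mul_sum]
  refine Finset.sum_congr rfl fun j hj => ?_
  have hj' := Finset.mem_Icc.1 hj
  obtain ⟨i, rfl⟩ : ∃ i, j = i + 1 := ⟨j - 1, by omega⟩
  rw [toFields_ω_sq' (by omega), toFields_ω_sq' (by omega)]
  have : γ N (i + 1) - γ N (i + 1 - 1) = (N : ℝ) + 1 - 2 * ((i + 1 : ℕ) : ℝ) := by
    simp only [γ, Nat.add_sub_cancel]
    push_cast
    ring
  rw [one_mul, ← this]
  field_simp
  ring

/-- The constant part cancels because the second difference of `γ` is `2`. What is left is minus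
half the second difference of `γ (2u + u²)`, on which `A` acts diagonally. -/
theorem toFields_W {j : ℕ} (hj : j ∈ Finset.Icc 1 (N - 1)) :
    (toFields N y M).W 1 j r = -(r ^ 2 * expand N r (eigenMul (magCoeff N (y r))) j)
      - r ^ 4 / 2 *
        expand N r (eigenMul (star N r (magCoeff N (y r)) (magCoeff N (y r)))) j := by
  have hj' := Finset.mem_Icc.1 hj
  obtain ⟨i, rfl⟩ : ∃ i, j = i + 1 := ⟨j - 1, by omega⟩
  rw [← secondDiff_expand hj, ← secondDiff_expand hj]
  simp only [secondDiff, Nat.add_sub_cancel]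
  rw [γ_mul_expand_star (by omega), γ_mul_expand_star (by omega), γ_mul_expand_star (by omega),
    Fields.W, toFields_ω_sq (by omega), toFields_ω_sq (by omega), toFields_ω_sq (by omega)]
  have : 2 * γ N (i + 1) - γ N i - γ N (i + 1 + 1) = 2 := by
    simp only [γ]
    push_cast
    ring
  simp only [Nat.add_sub_cancel]
  linear_combination (-1 / 2) * this

theorem γ_mul_toFields_E {j : ℕ} (hj : j ≤ N) :
    γ N j * (toFields N y M).E j r = γ N j * (r * expand N r (elCoeff N (y r)) j) := by
  rcases Nat.eq_zero_or_pos j with rfl | h0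
  · simp [γ_zero]
  · rcases hj.eq_or_lt with rfl | h1
    · simp [γ_self]
    · rw [toFields_E (Finset.mem_Icc.2 ⟨h0, by omega⟩)]

theorem toFields_Z {j : ℕ} (hj : j ∈ Finset.Icc 1 (N - 1)) :
    (toFields N y M).Z j r = r * (expand N r (eigenMul (elCoeff N (y r))) j
      + r ^ 2 * (2 * expand N r (eigenMul (star N r (magCoeff N (y r)) (elCoeff N (y r)))) j)
      + r ^ 4 * expand N r (eigenMul (star N r (star N r (magCoeff N (y r)) (magCoeff N (y r)))
          (elCoeff N (y r)))) j) := by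
  have hj' := Finset.mem_Icc.1 hj
  have key : ∀ i ≤ N, (toFields N y M).ω i r ^ 2 * (toFields N y M).E i r
      = r * (γ N i * expand N r (elCoeff N (y r)) i
        + r ^ 2 * (2 * (γ N i * expand N r (star N r (magCoeff N (y r)) (elCoeff N (y r))) i))
        + r ^ 4 * (γ N i * expand N r (star N r (star N r (magCoeff N (y r)) (magCoeff N (y r)))
          (elCoeff N (y r))) i)) := fun i hi => by
    rw [γ_mul_expand_star hi, γ_mul_expand_star hi, toFields_ω_sq hi, mul_right_comm,
      γ_mul_toFields_E hi, ← mul_assoc (γ N i) (expand N r (star N r _ _) i), γ_mul_expand_star hi]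
    ring
  rw [← secondDiff_expand hj, ← secondDiff_expand hj, ← secondDiff_expand hj]
  simp only [secondDiff]
  rw [Fields.Z, mul_assoc, key j (by omega), key (j - 1) (by omega), key (j + 1) (by omega)]
  ring

/-- A solution of the singular system yields a solution of the field equations. -/
theorem fieldEquationsAt_toFields (hN : 2 ≤ N) (hr : r ≠ 0)
    (hmag : ∀ᶠ x in 𝓝 r, ∀ a, HasDerivAt (fun x => y x (mag a)) (y x (magDeriv a)) x)
    (hmag' : ∀ a, HasDerivAt (fun x => y x (magDeriv a))
      (magRhs N ℓ r (y r) (M r) a - (2 * a + 4) * y r (magDeriv a) / r) r)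
    (hel : ∀ᶠ x in 𝓝 r, ∀ a, HasDerivAt (fun x => y x (el a)) (y x (elDeriv a)) x)
    (hel' : ∀ a, HasDerivAt (fun x => y x (elDeriv a))
      (elRhs N ℓ r (y r) (M r) a - (2 * a + 4) * y r (elDeriv a) / r) r)
    (hS : HasDerivAt (fun x => y x metric) (r * sigmaFn N ℓ r (y r) * y r metric) r)
    (hM : HasDerivAt M ((massFn N ℓ r (y r) - 3 * M r) / r) r)
    (hn : y r massRatio = r ^ 2 * M r) (hS₀ : y r metric ≠ 0) (hμ : muFn N ℓ r (y r) ≠ 0) :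
    (toFields N y M).FieldEquationsAt 1 ℓ N r := by
  have hμF := toFields_μ (ℓ := ℓ) hn
  have hηF := toFields_η (M := M) hr hel.self_of_nhds
  have hζF := toFields_ζ (N := N) (r := r) (y := y) (M := M)
  have hGF := toFields_G (M := M) hr hmag.self_of_nhds
  have hPF := toFields_P (N := N) (y := y) (M := M) hr
  have hSd : deriv (toFields N y M).S r / (toFields N y M).S r = r * sigmaFn N ℓ r (y r) := by
    change deriv (fun x => y x metric) r / y r metric = _
    rw [hS.deriv, mul_div_cancel_right₀ _ hS₀]
  have hSe : (toFields N y M).S r = y r metric := rfl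
  have hme : (toFields N y M).m r = r ^ 3 * M r := rfl
  -- Since `μ - 1` is of order `r²`, the eigenvalue terms on the two sides of the Yang-Mills
  -- equations, which differ by the factor `μ`, leave a regular remainder.
  have hν : muFn N ℓ r (y r) = 1 + r ^ 2 * nuFn ℓ (M r) := by
    rw [muFn, nuFn, hn]
    ring
  refine ⟨?_, ?_, ?_, ?_, ?_, ?_, ?_, fun j hj => ?_, fun j hj => ?_⟩
  · simp [toFields]
  · simp [toFields]
  · simp [toFields]
  · simp [toFields]
  · rw [← sum_traceless (by omega : N ≠ 0) fun i => r * expand N r (elCoeff N (y r)) i]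
    exact Finset.sum_congr rfl fun j hj => if_pos hj
  · have h1 : HasDerivAt (toFields N y M).m (r ^ 2 * massFn N ℓ r (y r)) r := by
      refine ((hasDerivAt_pow 3 r).mul hM).congr_deriv ?_
      field_simp
      push_cast
      ring
    rw [h1.deriv, hμF, hηF, hζF, hGF, hPF, hSe, massFn]
    ring
  · rw [hSd, hμF, hζF, hGF, hSe, sigmaFn]
    field_simp
  · have h1 := deriv_deriv_toFields_E hr hel hel' hj
    have h2 : deriv ((toFields N y M).E j) r = expand N r (elCoeff₁ N r (y r)) j :=
      (eventually_deriv_toFields_E (M := M) hr hel hj).self_of_nhds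
    rw [hSd, hμF, toFields_Z hj]
    simp only [elRhs, map_add, map_smul, Pi.add_apply, Pi.smul_apply, smul_eq_mul] at h1
    rw [h2] at h1 ⊢
    generalize expand N r (elCoeff₁ N r (y r)) j = t1 at h1 ⊢
    generalize expand N r (eigenMul (elCoeff N (y r))) j = t2 at h1 ⊢
    generalize expand N r (eigenMul (star N r (magCoeff N (y r)) (elCoeff N (y r)))) j = t3
      at h1 ⊢
    generalize expand N r (eigenMul (star N r (star N r (magCoeff N (y r)) (magCoeff N (y r)))
      (elCoeff N (y r)))) j = t4 at h1 ⊢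
    generalize deriv (deriv ((toFields N y M).E j)) r = d2 at h1 ⊢
    generalize sigmaFn N ℓ r (y r) = σ at h1 ⊢
    generalize muFn N ℓ r (y r) = μ at hν hμ h1 ⊢
    generalize nuFn ℓ (M r) = ν at hν h1
    -- `h1` solved for the second derivative; the equation is then a rational identity modulo `hν`.
    have hd2 : d2 = (t2 + r ^ 2 * (σ * t1 + 1 / μ * (-ν * t2 + 2 * t3 + r ^ 2 * t4)) - 2 * t1) / r := by
      field_simp
      field_simp at h1
      linear_combination h1
    rw [hd2]
    field_simp
    linear_combination t2 * hν
  · have h1 := deriv_deriv_toFields_ω hr hmag hmag' j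
    have h2 := (eventually_deriv_toFields_ω (M := M) hr hmag j).self_of_nhds
    rw [hμF, h1, h2, toFields_W hj, hPF, hηF, toFields_E hj, toFields_ω, hSe, hme]
    simp only [magRhs, magSource, map_add, map_sub, map_smul, Pi.add_apply, Pi.sub_apply,
      Pi.smul_apply, smul_eq_mul, expand_star hj]
    generalize expand N r (magCoeff₁ N r (y r)) j = t1
    generalize expand N r (eigenMul (magCoeff N (y r))) j = t2
    generalize expand N r (eigenMul (star N r (magCoeff N (y r)) (magCoeff N (y r)))) j = t3
    generalize expand N r (magCoeff N (y r)) j = t4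
    generalize expand N r (elCoeff N (y r)) j = t5
    generalize √(γ N j) = w
    generalize etaFn N r (y r) = η
    generalize pFn N r (y r) = p
    generalize muFn N ℓ r (y r) = μ at hν hμ ⊢
    generalize nuFn ℓ (M r) = ν at hν
    generalize y r metric = S at hS₀ ⊢
    have hν' : ν = (μ - 1) / r ^ 2 := by
      rw [hν]
      field_simp
      ring
    rw [hν']
    field_simp
    ring

end

end

/-! ### Analyticity of the right-hand sides, and the initial values. -/

section

open Filter Topology Component
open scoped unitInterval

section Analyticity

variable {W : Type*} [NormedAddCommGroup W] [NormedSpace ℝ W] {w₀ : W} {ρ m : W → ℝ} {N : ℕ} {ℓ : ℝ}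

theorem analyticAt_expand (hρ : AnalyticAt ℝ ρ w₀) {X : W → Fin (N - 1) → ℝ}
    (hX : ∀ a, AnalyticAt ℝ (fun w => X w a) w₀) (j : ℕ) :
    AnalyticAt ℝ (fun w => expand N (ρ w) (X w) j) w₀ := by
  simp only [expand_apply]
  exact Finset.analyticAt_fun_sum _ fun a _ => ((hX a).mul analyticAt_const).mul (hρ.pow _)

theorem analyticAt_star (hρ : AnalyticAt ℝ ρ w₀) {X X' : W → Fin (N - 1) → ℝ}
    (hX : ∀ a, AnalyticAt ℝ (fun w => X w a) w₀) (hX' : ∀ a, AnalyticAt ℝ (fun w => X' w a) w₀)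
    (a : Fin (N - 1)) : AnalyticAt ℝ (fun w => star N (ρ w) (X w) (X' w) a) w₀ :=
  Finset.analyticAt_fun_sum _ fun b _ => Finset.analyticAt_fun_sum _ fun c _ =>
    ((analyticAt_const.mul (hX b)).mul (hX' c)).mul (hρ.pow _)

theorem analyticAt_eigenMul {n : ℕ} {X : W → Fin n → ℝ}
    (hX : ∀ a, AnalyticAt ℝ (fun w => X w a) w₀) (a : Fin n) :
    AnalyticAt ℝ (fun w => eigenMul (X w) a) w₀ :=
  analyticAt_const.mul (hX a)

theorem analyticAt_traceless {w : W → ℕ → ℝ} (hw : ∀ i, AnalyticAt ℝ (fun x => w x i) w₀) (j : ℕ) :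
    AnalyticAt ℝ (fun x => traceless N (w x) j) w₀ := by
  refine (Finset.analyticAt_fun_sum _ fun i _ => ?_).sub
    (analyticAt_const.mul (Finset.analyticAt_fun_sum _ fun i _ => analyticAt_const.mul (hw i)))
  split_ifs
  · exact hw i
  · exact analyticAt_const

variable {y : W → Component (N - 1) → ℝ} (hρ : AnalyticAt ℝ ρ w₀)
  (hy : ∀ i, AnalyticAt ℝ (fun w => y w i) w₀)

include hy

theorem analyticAt_magCoeff (a : Fin (N - 1)) : AnalyticAt ℝ (fun w => magCoeff N (y w) a) w₀ :=
  hy _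

theorem analyticAt_elCoeff (a : Fin (N - 1)) : AnalyticAt ℝ (fun w => elCoeff N (y w) a) w₀ :=
  hy _

include hρ

theorem analyticAt_magCoeff₁ (a : Fin (N - 1)) :
    AnalyticAt ℝ (fun w => magCoeff₁ N (ρ w) (y w) a) w₀ :=
  (analyticAt_const.mul (hy _)).add (hρ.mul (hy _))

theorem analyticAt_elCoeff₁ (a : Fin (N - 1)) :
    AnalyticAt ℝ (fun w => elCoeff₁ N (ρ w) (y w) a) w₀ :=
  (analyticAt_const.mul (hy _)).add (hρ.mul (hy _))

theorem analyticAt_muFn : AnalyticAt ℝ (fun w => muFn N ℓ (ρ w) (y w)) w₀ :=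
  (analyticAt_const.sub (analyticAt_const.mul (hy _))).add ((hρ.pow 2).div_const)

theorem analyticAt_etaFn : AnalyticAt ℝ (fun w => etaFn N (ρ w) (y w)) w₀ :=
  Finset.analyticAt_fun_sum _ fun j _ =>
    (analyticAt_traceless (analyticAt_expand hρ (analyticAt_elCoeff₁ hρ hy)) j).pow 2

theorem analyticAt_zetaFn : AnalyticAt ℝ (fun w => zetaFn N (ρ w) (y w)) w₀ :=
  Finset.analyticAt_fun_sum _ fun j _ => (analyticAt_const.mul ((analyticAt_const.add
    ((hρ.pow 2).mul (analyticAt_expand hρ (analyticAt_magCoeff hy) j))).pow 2)).mul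
      ((analyticAt_expand hρ (analyticAt_elCoeff hy) j).pow 2)

theorem analyticAt_gFn : AnalyticAt ℝ (fun w => gFn N (ρ w) (y w)) w₀ :=
  Finset.analyticAt_fun_sum _ fun j _ =>
    analyticAt_const.mul ((analyticAt_expand hρ (analyticAt_magCoeff₁ hρ hy) j).pow 2)

theorem analyticAt_sqDefect (j : ℕ) : AnalyticAt ℝ (fun w => sqDefect N (ρ w) (y w) j) w₀ :=
  (analyticAt_const.mul (analyticAt_expand hρ (analyticAt_magCoeff hy) j)).add
    ((hρ.pow 2).mul ((analyticAt_expand hρ (analyticAt_magCoeff hy) j).pow 2))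

theorem analyticAt_pFn : AnalyticAt ℝ (fun w => pFn N (ρ w) (y w)) w₀ :=
  analyticAt_const.mul (Finset.analyticAt_fun_sum _ fun j _ =>
    ((analyticAt_const.mul (analyticAt_sqDefect hρ hy j)).sub
      (analyticAt_const.mul (analyticAt_sqDefect hρ hy (j - 1)))).pow 2)

variable (hμ : muFn N ℓ (ρ w₀) (y w₀) ≠ 0) (hS : y w₀ metric ≠ 0)

include hμ hS

theorem analyticAt_massFn : AnalyticAt ℝ (fun w => massFn N ℓ (ρ w) (y w)) w₀ := by
  have h1 := analyticAt_etaFn hρ hy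
  have h2 := analyticAt_zetaFn hρ hy
  have h3 := analyticAt_muFn (ℓ := ℓ) hρ hy
  have h4 := analyticAt_gFn hρ hy
  have h5 := analyticAt_pFn hρ hy
  have h6 := hy metric
  exact (((h1.div (analyticAt_const.mul (h6.pow 2)) (mul_ne_zero four_ne_zero (pow_ne_zero 2 hS))).add
    (h2.div ((analyticAt_const.mul h3).mul (h6.pow 2))
      (mul_ne_zero (mul_ne_zero four_ne_zero hμ) (pow_ne_zero 2 hS)))).add (h3.mul h4)).add h5

theorem analyticAt_sigmaFn : AnalyticAt ℝ (fun w => sigmaFn N ℓ (ρ w) (y w)) w₀ :=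
  ((analyticAt_zetaFn hρ hy).div ((analyticAt_const.mul ((analyticAt_muFn (ℓ := ℓ) hρ hy).pow 2)).mul
    ((hy metric).pow 2)) (mul_ne_zero (mul_ne_zero two_ne_zero (pow_ne_zero 2 hμ))
      (pow_ne_zero 2 hS))).add (analyticAt_const.mul (analyticAt_gFn hρ hy))

variable (hm : AnalyticAt ℝ m w₀)

include hm

theorem analyticAt_magRhs (a : Fin (N - 1)) :
    AnalyticAt ℝ (fun w => magRhs N ℓ (ρ w) (y w) (m w) a) w₀ := by
  have h1 := analyticAt_etaFn hρ hy
  have h3 := analyticAt_muFn (ℓ := ℓ) hρ hy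
  have h5 := analyticAt_pFn hρ hy
  have h6 := hy metric
  have hB := analyticAt_magCoeff hy
  have hE := analyticAt_elCoeff hy
  have hEE := analyticAt_star hρ hE hE
  have hBB := analyticAt_star hρ hB hB
  have hr2 := hρ.pow 2
  refine (analyticAt_const.div h3 hμ).mul (AnalyticAt.sub ?_
    (((analyticAt_const.mul hm).add analyticAt_const).mul (analyticAt_eigenMul hB a)))
  refine ((((AnalyticAt.mul ?_ (analyticAt_magCoeff₁ hρ hy a)).sub (AnalyticAt.mul ?_
    ((hEE a).add (hr2.mul (analyticAt_star hρ hB hEE a))))).add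
    (analyticAt_const.mul (analyticAt_eigenMul hBB a))).add
    (analyticAt_star hρ (analyticAt_eigenMul hB) hB a)).add
    (hr2.div_const.mul (analyticAt_star hρ (analyticAt_eigenMul hBB) hB a))
  · exact analyticAt_const.mul (((hm.sub h5).add analyticAt_const).sub
      (h1.div (analyticAt_const.mul (h6.pow 2)) (mul_ne_zero four_ne_zero (pow_ne_zero 2 hS))))
  · exact analyticAt_const.div ((analyticAt_const.mul h3).mul (h6.pow 2))
      (mul_ne_zero (mul_ne_zero four_ne_zero hμ) (pow_ne_zero 2 hS))

theorem analyticAt_elRhs (a : Fin (N - 1)) :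
    AnalyticAt ℝ (fun w => elRhs N ℓ (ρ w) (y w) (m w) a) w₀ := by
  have h3 := analyticAt_muFn (ℓ := ℓ) hρ hy
  have hB := analyticAt_magCoeff hy
  have hE := analyticAt_elCoeff hy
  have hBB := analyticAt_star hρ hB hB
  exact ((analyticAt_sigmaFn hρ hy hμ hS).mul (analyticAt_elCoeff₁ hρ hy a)).add
    ((analyticAt_const.div h3 hμ).mul (((((analyticAt_const.mul hm).add analyticAt_const).neg.mul
      (analyticAt_eigenMul hE a)).add
      (analyticAt_const.mul (analyticAt_eigenMul (analyticAt_star hρ hB hE) a))).add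
      ((hρ.pow 2).mul (analyticAt_eigenMul (analyticAt_star hρ hBB hE) a))))

theorem analyticAt_systemRhs (i : Component (N - 1)) :
    AnalyticAt ℝ (fun w => systemRhs N ℓ i ((ρ w, y w), m w)) w₀ := by
  cases i with
  | mag a => exact hy _
  | magDeriv a => exact analyticAt_magRhs hρ hy hμ hS hm a
  | el a => exact hy _
  | elDeriv a => exact analyticAt_elRhs hρ hy hμ hS hm a
  | metric => exact (hρ.mul (analyticAt_sigmaFn hρ hy hμ hS)).mul (hy _)
  | massRatio => exact hρ.mul (analyticAt_massFn hρ hy hμ hS)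

end Analyticity

/-- The initial values of the singular system. -/
def initialValue (N : ℕ) (S₀ : ℝ) (p : Params N) : Component (N - 1) → ℝ
  | mag a => p.1 a
  | magDeriv _ => 0
  | el a => p.2 a
  | elDeriv _ => 0
  | metric => S₀
  | massRatio => 0

theorem analyticAt_initialValue (N : ℕ) (S₀ : ℝ) (p : Params N) :
    AnalyticAt ℝ (initialValue N S₀) p := by
  refine AnalyticAt.pi fun i => ?_
  cases i with
  | mag a => exact ((ContinuousLinearMap.proj (R := ℝ) (φ := fun _ : Fin (N - 1) => ℝ) a).comp
      (ContinuousLinearMap.fst ℝ _ _)).analyticAt p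
  | el a => exact ((ContinuousLinearMap.proj (R := ℝ) (φ := fun _ : Fin (N - 1) => ℝ) a).comp
      (ContinuousLinearMap.snd ℝ _ _)).analyticAt p
  | magDeriv a => exact analyticAt_const
  | elDeriv a => exact analyticAt_const
  | metric => exact analyticAt_const
  | massRatio => exact analyticAt_const

theorem muFn_zero (N : ℕ) (ℓ S₀ : ℝ) (p : Params N) :
    muFn N ℓ 0 (initialValue N S₀ p) = 1 := by
  simp [muFn, initialValue]

/-- A function whose integral equation has a right hand side of the form `x b(x)` is constant up to
terms of second order. -/
theorem isBigO_sq_of_integral {g b : ℝ → ℝ} {c : ℝ} (hb : ContinuousAt b 0)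
    (hg : ∀ᶠ r in 𝓝 0, g r = c + r * ∫ s in (0 : ℝ)..1, r * s * b (r * s)) :
    (fun r => g r - c) =O[𝓝 0] fun r => r ^ 2 := by
  obtain ⟨δ, hδ, hbδ⟩ := Metric.eventually_nhds_iff_ball.1
    (hb.norm.eventually (gt_mem_nhds (lt_add_one ‖b 0‖)))
  refine IsBigO.of_bound (‖b 0‖ + 1) ?_
  filter_upwards [hg, Metric.ball_mem_nhds (0 : ℝ) hδ] with r hr hrδ
  rw [hr, add_sub_cancel_left, norm_mul, norm_pow]
  have hle : ‖∫ s in (0 : ℝ)..1, r * s * b (r * s)‖ ≤ ‖r‖ * (‖b 0‖ + 1) * |1 - 0| := by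
    refine intervalIntegral.norm_integral_le_of_norm_le_const fun s hs => ?_
    rw [Set.uIoc_of_le zero_le_one] at hs
    have hs1 : ‖r * s‖ ≤ ‖r‖ := by
      rw [norm_mul]
      refine mul_le_of_le_one_right (norm_nonneg _) ?_
      rw [Real.norm_of_nonneg hs.1.le]
      exact hs.2
    rw [norm_mul]
    refine mul_le_mul hs1 (hbδ _ ?_).le (norm_nonneg _) (norm_nonneg _)
    rw [mem_ball_zero_iff] at hrδ ⊢
    exact hs1.trans_lt hrδ
  calc ‖r‖ * ‖∫ s in (0 : ℝ)..1, r * s * b (r * s)‖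
      ≤ ‖r‖ * (‖r‖ * (‖b 0‖ + 1) * |1 - 0|) := by gcongr
    _ = (‖b 0‖ + 1) * ‖r‖ ^ 2 := by
      rw [sub_zero, abs_one]
      ring

end

end EYM

end

/-! ### The main theorem. -/

open EYM EYM.Component Filter Topology

theorem mainTheorem4 (N : ℕ) (hN : 2 ≤ N) (ℓ S₀ : ℝ) (hℓ : 0 < ℓ) (hS₀ : S₀ ≠ 0) :
    -- the vectors `v_k` are eigenvectors of `A`, with eigenvalues `k (k + 1)`
    (∀ k : Fin (N - 1), Module.End.HasEigenvector (Matrix.toLin' (EYM.A N))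
      (((k : ℝ) + 1) * ((k : ℝ) + 2)) (fun j : Fin (N - 1) => EYM.v N (k + 1) (j + 1))) ∧
    ∃ (U : Set (ℝ × EYM.Params N)) (F : EYM.Params N → EYM.Fields)
      (β θ : Fin (N - 1) → ℝ × EYM.Params N → ℝ),
      IsOpen U ∧ (∀ p : EYM.Params N, ((0 : ℝ), p) ∈ U) ∧
      -- joint analyticity in the radius and in the initial parameters
      AnalyticOnNhd ℝ (fun z => (F z.2).m z.1) U ∧
      AnalyticOnNhd ℝ (fun z => (F z.2).S z.1) U ∧
      (∀ j ∈ Finset.Icc 1 N, AnalyticOnNhd ℝ (fun z => (F z.2).α j z.1) U) ∧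
      (∀ j ∈ Finset.Icc 1 (N - 1), AnalyticOnNhd ℝ (fun z => (F z.2).ω j z.1) U) ∧
      (∀ k, AnalyticOnNhd ℝ (β k) U) ∧ (∀ k, AnalyticOnNhd ℝ (θ k) U) ∧
      -- the `2N - 2` initial parameters
      (∀ p k, β k (0, p) = p.1 k) ∧ (∀ p k, θ k (0, p) = p.2 k) ∧
      -- the behaviour of the fields at the origin
      (∀ p, (F p).m =O[nhds 0] fun r => r ^ 3) ∧
      (∀ p, (F p).S 0 = S₀ ∧ (fun r => (F p).S r - S₀) =O[nhds 0] fun r => r ^ 2) ∧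
      (∀ r p, (r, p) ∈ U → ∀ j ∈ Finset.Icc 1 (N - 1),
        (F p).ω j r = Real.sqrt ((j : ℝ) * ((N : ℝ) - j)) *
          (1 + ∑ k : Fin (N - 1), β k (r, p) * EYM.v N (k + 1) j * r ^ ((k : ℕ) + 2)) ∧
        (F p).E j r = ∑ k : Fin (N - 1), θ k (r, p) * EYM.v N (k + 1) j * r ^ ((k : ℕ) + 1)) ∧
      -- the metric is non-degenerate and the field equations hold, with `k = 1`
      (∀ r p, (r, p) ∈ U → 0 < (F p).μ 1 ℓ r ∧ (F p).S r ≠ 0) ∧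
      (∀ r p, (r, p) ∈ U → r ≠ 0 → (F p).FieldEquationsAt 1 ℓ N r) := by
  refine ⟨hasEigenvector_v hN, ?_⟩
  let h : ℝ × (Component (N - 1) → ℝ) → ℝ := fun z => massFn N ℓ z.1 z.2
  have hμ₀ : ∀ p, muFn N ℓ 0 (initialValue N S₀ p) ≠ 0 := fun p => by simp [muFn_zero]
  have hcoord : ∀ (i : Component (N - 1)) (z : Component (N - 1) → ℝ),
      AnalyticAt ℝ (fun z : Component (N - 1) → ℝ => z i) z := fun i z =>
    (ContinuousLinearMap.proj (R := ℝ) (φ := fun _ : Component (N - 1) => ℝ) i).analyticAt z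
  have hh : ∀ p, AnalyticAt ℝ h (0, initialValue N S₀ p) := fun p =>
    analyticAt_massFn (ρ := Prod.fst) (y := Prod.snd) analyticAt_fst
      (fun i => AnalyticAt.comp (f := Prod.snd) (hcoord i _) analyticAt_snd) (hμ₀ p) hS₀
  have hf : ∀ p i, AnalyticAt ℝ (systemRhs N ℓ i)
      ((0, initialValue N S₀ p), h (0, initialValue N S₀ p) / ((2 : ℕ) + 1)) := fun p i =>
    analyticAt_systemRhs (W := (ℝ × (Component (N - 1) → ℝ)) × ℝ) (ρ := fun z => z.1.1)
      (y := fun z => z.1.2) (m := Prod.snd) (AnalyticAt.comp analyticAt_fst analyticAt_fst)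
      (fun i => AnalyticAt.comp (f := fun z : (ℝ × (Component (N - 1) → ℝ)) × ℝ => z.1.2)
        (hcoord i _) (AnalyticAt.comp analyticAt_snd analyticAt_fst)) (hμ₀ p) hS₀ analyticAt_snd i
  -- The weight `κ = 2` reflects `m' = r² massFn`: for `M = m / r³` this reads `r M' = -3 M +
  -- massFn`.
  obtain ⟨U₀, Y, hU₀, hU₀0, hY⟩ := exists_solution (e := systemExponent N) (κ := 2)
    (analyticAt_initialValue N S₀) hh hf
  let M : ℝ × Params N → ℝ := fun z => massAverage h 2 (fun r => Y (r, z.2)) z.1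
  have hYi : ∀ z ∈ U₀, ∀ i, AnalyticAt ℝ (fun z => Y z i) z := fun z hz i =>
    AnalyticAt.comp (hcoord i _) (hY z hz).2.1
  have hMan : ∀ z ∈ U₀, AnalyticAt ℝ M z := fun z hz => (hY z hz).2.2.1
  -- Cut down by the two open nondegeneracy conditions, which hold at `r = 0`. Unlike `U₀`, this set
  -- need not contain the segments to `r = 0`, so integral equations are still handled on `U₀`.
  let U : Set (ℝ × Params N) := {z | z ∈ U₀ ∧ Y z metric ≠ 0 ∧ 0 < muFn N ℓ z.1 (Y z)}
  have hU : IsOpen U := by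
    refine isOpen_iff_mem_nhds.2 fun z hz => ?_
    have h1 := (hYi z hz.1 metric).continuousAt
    have h2 := (analyticAt_muFn (ℓ := ℓ) analyticAt_fst (hYi z hz.1)).continuousAt
    filter_upwards [hU₀.mem_nhds hz.1, h1.eventually_ne hz.2.1, h2.eventually (lt_mem_nhds hz.2.2)]
      with w hw1 hw2 hw3 using ⟨hw1, hw2, hw3⟩
  have hY0 : ∀ p, Y (0, p) = initialValue N S₀ p := fun p => by
    ext i
    have := (hY _ (hU₀0 p)).2.2.2.2.2 i
    simpa using this
  have hslice : ∀ r p, (r, p) ∈ U₀ → ∀ᶠ x in 𝓝 r, (x, p) ∈ U₀ := fun r p hrp =>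
    (hU₀.preimage (f := fun x => (x, p)) (by fun_prop)).mem_nhds hrp
  have hYr : ∀ r p, (r, p) ∈ U₀ → AnalyticAt ℝ (fun x => Y (x, p)) r := fun r p hrp =>
    AnalyticAt.comp (f := fun x : ℝ => (x, p)) (hY _ hrp).2.1 (analyticAt_id.prod analyticAt_const)
  have hMr : ∀ r p, (r, p) ∈ U₀ → AnalyticAt ℝ (fun x => M (x, p)) r := fun r p hrp =>
    AnalyticAt.comp (f := fun x : ℝ => (x, p)) (hMan _ hrp) (analyticAt_id.prod analyticAt_const)
  -- The mass enters twice, as `m / r` and as `m / r³`. The two are consistent because weight `s`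
  -- with source `r s h` is `r` times weight `s²` with source `h`.
  have hratio : ∀ r p, (r, p) ∈ U₀ → Y (r, p) massRatio = r ^ 2 * M (r, p) := by
    intro r p hrp
    have h1 := (hY _ hrp).2.2.2.2.2 massRatio
    simp only [systemRhs, systemExponent, initialValue, zero_add] at h1
    rw [h1, pow_two, mul_assoc]
    congr 1
    simp only [M, massAverage]
    rw [← intervalIntegral.integral_const_mul]
    refine intervalIntegral.integral_congr fun s _ => ?_
    simp only [h]
    ring
  refine ⟨U, fun p => toFields N (fun r => Y (r, p)) (fun r => M (r, p)), fun k z => Y z (mag k),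
    fun k z => Y z (el k), hU, fun p => ⟨hU₀0 p, ?_, ?_⟩, fun z hz => ?_, fun z hz => ?_,
    fun j hj z hz => ?_, fun j _ z hz => ?_, fun k z hz => hYi z hz.1 _,
    fun k z hz => hYi z hz.1 _, fun p k => ?_, fun p k => ?_, fun p => ?_, fun p => ⟨?_, ?_⟩,
    fun r p hrp j hj => ⟨?_, ?_⟩, fun r p hrp => ⟨?_, hrp.2.1⟩, fun r p hrp hr => ?_⟩
  · rw [hY0]
    exact hS₀
  · simp [hY0, muFn_zero]
  · exact (analyticAt_fst.pow 3).mul (hMan z hz.1)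
  · exact hYi z hz.1 _
  · simp only [toFields, if_pos hj]
    exact analyticAt_traceless (fun i => analyticAt_fst.mul
      (analyticAt_expand analyticAt_fst (analyticAt_elCoeff (hYi z hz.1)) i)) j
  · exact analyticAt_const.mul (analyticAt_const.add ((analyticAt_fst.pow 2).mul
      (analyticAt_expand analyticAt_fst (analyticAt_magCoeff (hYi z hz.1)) j)))
  · simp only [hY0]
    rfl
  · simp only [hY0]
    rfl
  · have h1 := ((hMr 0 p (hU₀0 p)).continuousAt).isBigO_one ℝ
    have h2 := (isBigO_refl (fun r : ℝ => r ^ 3) (𝓝 0)).mul h1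
    simp only [mul_one] at h2
    exact h2
  · change Y (0, p) metric = S₀
    rw [hY0]
    rfl
  · refine isBigO_sq_of_integral (b := fun x => sigmaFn N ℓ x (Y (x, p)) * Y (x, p) metric) ?_ ?_
    · have h1 : ∀ i, AnalyticAt ℝ (fun x => Y (x, p) i) 0 := fun i =>
        AnalyticAt.comp (hcoord i _) (hYr 0 p (hU₀0 p))
      refine ((analyticAt_sigmaFn analyticAt_id h1 ?_ ?_).mul (h1 metric)).continuousAt
      · simp [hY0, muFn_zero]
      · rw [hY0]
        exact hS₀
    · filter_upwards [hslice 0 p (hU₀0 p)] with r hr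
      have h1 := (hY _ hr).2.2.2.2.2 metric
      simp only [systemRhs, systemExponent, initialValue] at h1
      change Y (r, p) metric = _
      rw [h1]
      congr 2
      refine intervalIntegral.integral_congr fun s _ => ?_
      ring
  · rw [toFields_ω]
    simp only
    rw [expand_apply, Finset.mul_sum, γ]
    congr 2
    refine Finset.sum_congr rfl fun k _ => ?_
    simp only [magCoeff]
    ring
  · rw [toFields_E hj]
    simp only
    rw [expand_apply, Finset.mul_sum]
    refine Finset.sum_congr rfl fun k _ => ?_
    simp only [elCoeff]
    ring
  · rw [toFields_μ (hratio r p hrp.1)]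
    exact hrp.2.2
  · have hcont : ∀ x, (x, p) ∈ U₀ → ∀ i, ContinuousAt
        (fun x => systemRhs N ℓ i ((x, Y (x, p)), massAverage h 2 (fun r => Y (r, p)) x)) x :=
      fun x hx i => ContinuousAt.comp
        (f := fun x => ((x, Y (x, p)), massAverage h 2 (fun r => Y (r, p)) x))
        ((hY _ hx).2.2.2.2.1 i).continuousAt
        ((continuousAt_id.prodMk (hYr x p hx).continuousAt).prodMk (hMr x p hx).continuousAt)
    -- Away from `r = 0` the integral equations are differentiated back into the singular system.
    have hode : ∀ x, x ≠ 0 → (x, p) ∈ U₀ → ∀ i, HasDerivAt (fun x => Y (x, p) i)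
        (systemRhs N ℓ i ((x, Y (x, p)), M (x, p))
          - systemExponent N i * (Y (x, p) i - initialValue N S₀ p i) / x) x := by
      intro x hx0 hx i
      refine hasDerivAt_of_isSolAt hx0 ?_ (fun i s => hcont _ ((hY _ hx).1 s) i) (fun i => ?_) i
      · filter_upwards [hslice x p hx] with x' hx' using (hY _ hx').2.2.2.2.2
      · filter_upwards [hslice x p hx] with x' hx' using hcont x' hx' i
    have hev : ∀ᶠ x in 𝓝 r, x ≠ 0 ∧ (x, p) ∈ U₀ :=
      Filter.Eventually.and (isOpen_ne.mem_nhds hr) (hslice r p hrp.1)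
    refine fieldEquationsAt_toFields hN hr ?_ (fun a => ?_) ?_ (fun a => ?_) ?_ ?_
      (hratio r p hrp.1) hrp.2.1 hrp.2.2.ne'
    · filter_upwards [hev] with x hx a
      simpa [systemRhs, systemExponent] using hode x hx.1 hx.2 (mag a)
    · simpa [systemRhs, systemExponent, initialValue] using hode r hr hrp.1 (magDeriv a)
    · filter_upwards [hev] with x hx a
      simpa [systemRhs, systemExponent] using hode x hx.1 hx.2 (el a)
    · simpa [systemRhs, systemExponent, initialValue] using hode r hr hrp.1 (elDeriv a)
    · simpa [systemRhs, systemExponent] using hode r hr hrp.1 metric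
    · have hφ : ∀ x, (x, p) ∈ U₀ → ContinuousAt (fun x => massFn N ℓ x (Y (x, p))) x := fun x hx =>
        ContinuousAt.comp (f := fun x => (x, Y (x, p))) (hY _ hx).2.2.2.1.continuousAt
          (continuousAt_id.prodMk (hYr x p hx).continuousAt)
      have h1 := hasDerivAt_average (φ := fun x => massFn N ℓ x (Y (x, p))) (k := 2) hr
        (fun s => hφ _ ((hY _ hrp.1).1 s))
        (by filter_upwards [hslice r p hrp.1] with x hx using hφ x hx)
      refine h1.congr_deriv ?_
      simp only [M, massAverage, h]
      norm_num
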